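/- Let $\mathbb S^3\subset\mathbb R^4$ be the unit sphere with its Riemannian surface measure (total mass $2\pi^2$), let $\|\cdot\|$ be the norm of $L^2(\mathbb S^3)$, let $\nabla$ and $\Delta$ be the gradient and the Laplace--Beltrami operator of $\mathbb S^3$, and let $\bar H^2(\mathbb S^3)$ be the space of real functions in the Sobolev space $H^2(\mathbb S^3)$ with $\int_{\mathbb S^3}u=0$. Every element of $H^2(\mathbb S^3)$ has a unique continuous representative, and $u(\xi)$ denotes its value at $\xi$. For $\xi\in\mathbb S^3$ and $D\ge 3$ (where $3$ is the first positive eigenvalue of $-\Delta$) put $$\mathbb V(\xi,D):=\sup\bigl\{|u(\xi)|^2:\ u\in\bar H^2(\mathbb S^3),\ \|\nabla u\|^2=1,\ \|\Delta u\|^2=D\bigr\}.$$ Then this is the supremum of a non-empty bounded set, $\mathbb V(\xi,D)=\mathbb V(D)$ is independent of $\xi\in\mathbb S^3$, and as $D\to\infty$ $$\mathbb V(D)=\frac1{2\pi}D^{1/2}-\frac3{4\pi^2}-\frac{9+4\pi^2}{16\pi^3}\,D^{-1/2}+O(D^{-1}).$$ -/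

import Mathlib

open MeasureTheory Filter Asymptotics
open scoped ContDiff Gradient

namespace ThreeSphere

/-- The ambient Euclidean space `ℝ⁴`. -/
abbrev Ambient : Type := EuclideanSpace ℝ (Fin 4)

/-- The unit sphere `𝕊³ ⊂ ℝ⁴`. -/
abbrev S3 : Type := Metric.sphere (0 : Ambient) 1

/-- The (unnormalized) Riemannian surface measure on `𝕊³`, of total mass `2π²`. -/
noncomputable abbrev surf : Measure S3 := (volume : Measure Ambient).toSphere

/-- The tangential (Riemannian) gradient on `𝕊³` of the restriction to `𝕊³` of a smooth function
`φ` on `ℝ⁴`: the orthogonal projection of `∇φ(x)` to the tangent space `x^⊥`. Every smooth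
function on `𝕊³` is such a restriction, and the result depends on `φ|_{𝕊³}` only. -/
noncomputable def tangentGrad (φ : Ambient → ℝ) (x : S3) : Ambient :=
  ∇ φ (x : Ambient) - (inner ℝ (x : Ambient) (∇ φ (x : Ambient))) • (x : Ambient)

/-- `g` is the weak tangential gradient of `u` on `𝕊³`. Integration by parts on the sphere reads
`∫ u ∇φ = -∫ φ ∇u + ∫ 3 u φ x`, where `3` is the mean curvature (trace of the shape operator) of
`𝕊³ ⊂ ℝ⁴` and `x` is the outer normal at `x`; it is required for every smooth `φ`. The `i`-th
coordinate of `g` is the weak tangential derivative of `u` in the direction of the tangential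
projection of the `i`-th basis vector. An integrable `g` of this kind is automatically tangent
to the sphere, and it is unique up to a null set. -/
def HasWeakGrad (u : S3 → ℝ) (g : S3 → Ambient) : Prop :=
  ∀ φ : Ambient → ℝ, ContDiff ℝ ∞ φ →
    ∫ x, u x • tangentGrad φ x ∂surf
      = ∫ x, (-(φ (x : Ambient)) • g x + (3 * u x * φ (x : Ambient)) • (x : Ambient)) ∂surf

/-- `u` belongs to the Sobolev space `H²(𝕊³)`, with weak gradient `g` and with weak second
derivatives `h`, where `h i` is the weak gradient of the `i`-th coordinate of `g`;
all of these are square integrable. -/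
structure IsH2 (u : S3 → ℝ) (g : S3 → Ambient) (h : Fin 4 → S3 → Ambient) : Prop where
  memLp : MemLp u 2 surf
  memLp_grad : MemLp g 2 surf
  memLp_hess : ∀ i, MemLp (h i) 2 surf
  weakGrad : HasWeakGrad u g
  weakHess : ∀ i, HasWeakGrad (fun x => g x i) (h i)

/-- Membership in `H²(𝕊³)`. -/
def MemH2 (u : S3 → ℝ) : Prop := ∃ g h, IsH2 u g h

/-- The Laplace-Beltrami operator `Δu = div ∇u`, the trace of the tangential second
derivatives. -/
def laplacian (h : Fin 4 → S3 → Ambient) (x : S3) : ℝ := ∑ i, h i x i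

/-- The set of the numbers `|u(ξ)|²`, where `u ∈ H²(𝕊³)` has zero mean, `‖∇u‖² = 1` and
`‖Δu‖² = D` (norms of `L²(𝕊³)`). The value at the point `ξ` is that of the continuous
representative of `u`. -/
def extremalValues (ξ : S3) (D : ℝ) : Set ℝ :=
  {v | ∃ (u : S3 → ℝ) (g : S3 → Ambient) (h : Fin 4 → S3 → Ambient),
    IsH2 u g h ∧ Continuous u ∧ ∫ x, u x ∂surf = 0 ∧
    ∫ x, ‖g x‖ ^ 2 ∂surf = 1 ∧ ∫ x, (laplacian h x) ^ 2 ∂surf = D ∧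
    v = |u ξ| ^ 2}

end ThreeSphere

namespace ThreeSphere

open Polynomial

/-! ### Continuous functions on the sphere and the invariance of the surface measure -/

/-! The extremal problem is solved by duality, with a Lagrange multiplier s. Let λ_n = n(n+2) be the
eigenvalues of -Δ. The zonal harmonic U_n(⟨ξ,x⟩), with U_n the Chebyshev polynomial of the second
kind, has squared norm 2π² and value n+1 at ξ. Cauchy-Schwarz for the form ∫ΔuΔv + s∫∇u·∇v against
zonal v gives, for every s ≥ 0 and u of zero mean, |u(ξ)|² ≤ (‖Δu‖² + s‖∇u‖²) (2π²)⁻¹ G(s), where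
G(s) = Σ_{n≥1} (n+1)²/(λ_n(λ_n+s)) (`IsH2.sq_apply_le`). Hence 2π² 𝕍(D) ≤ (D+s)G(s) for every s ≥ 0.

Conversely, the zonal function with coefficients proportional to (n+1)/(λ_n(λ_n+s)) gives equality,
provided that s makes the ratio ‖Δu‖²/‖∇u‖² equal to D. For truncated sums and large D such an s
exists by the intermediate value theorem, in a range independent of the truncation, and the tails
vanish in the limit. So 2π² 𝕍(D) is the infimum of (D+s)G(s) for large D
(`le_of_forall_le_weight_sum`).

Since λ_n + 1 = (n+1)², partial fractions and the cotangent series give, with s = a²+1, sG(s) =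
(πa/2) coth(πa) - 3/4 + 1/s (`tsum_weight`). With q = √D and s = (q/y)², the function to be
minimized is (1+y²)(sG(s)), of leading part (πq/2)(y+1/y). The constant -3/4 moves the minimizer
from 1 to about 1 + 3/(2πq), and this produces the term 9/(8πq); the term 4π²/(8πq) comes from a =
√(s-1). The choice of this y proves the upper bound (`exists_le_expansion`), and a completed square
proves the lower bound uniformly in s (`expansion_le`).

Evaluation of u at ξ requires a continuous representative. The harmonic expansion converges
uniformly by the same duality estimate, and the Poisson kernel identifies its limit with u. All
integrations by parts rest on the invariance of the surface measure under linear isometries. -/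

theorem integrable_of_continuous {E : Type*} [NormedAddCommGroup E] {f : S3 → E}
    (hf : Continuous f) : Integrable f surf :=
  hf.integrable_of_hasCompactSupport (HasCompactSupport.of_compactSpace f)

theorem integrable_mul_continuous {u c : S3 → ℝ} (hu : Integrable u surf) (hc : Continuous c) :
    Integrable (fun x => u x * c x) surf := by
  obtain ⟨C, hC⟩ := isCompact_univ.exists_bound_of_continuousOn hc.continuousOn
  exact hu.mul_bdd hc.aestronglyMeasurable (Eventually.of_forall fun x => hC x trivial)

theorem sum_sq_coord (x : S3) :
    (x : Ambient) 0 ^ 2 + (x : Ambient) 1 ^ 2 + (x : Ambient) 2 ^ 2 + (x : Ambient) 3 ^ 2 = 1 := by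
  have h : ‖(x : Ambient)‖ ^ 2 = 1 := by rw [norm_eq_of_mem_sphere x]; norm_num
  rw [EuclideanSpace.norm_sq_eq, Fin.sum_univ_four] at h
  simpa using h

/-- The homeomorphism of the sphere induced by a linear isometry. -/
noncomputable def sphereHomeo (L : Ambient ≃ₗᵢ[ℝ] Ambient) : S3 ≃ₜ S3 where
  toFun x := ⟨L x, by simp⟩
  invFun x := ⟨L.symm x, by simp⟩
  left_inv x := by ext1; simp
  right_inv x := by ext1; simp
  continuous_toFun := by fun_prop
  continuous_invFun := by fun_prop

@[simp]
theorem coe_sphereHomeo (L : Ambient ≃ₗᵢ[ℝ] Ambient) (x : S3) :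
    (sphereHomeo L x : Ambient) = L x := rfl

theorem measurePreserving_sphereHomeo (L : Ambient ≃ₗᵢ[ℝ] Ambient) :
    MeasurePreserving (sphereHomeo L).toMeasurableEquiv surf surf := by
  refine ⟨(sphereHomeo L).toMeasurableEquiv.measurable, ?_⟩
  ext s hs
  have hpre := (sphereHomeo L).toMeasurableEquiv.measurable hs
  rw [MeasurableEquiv.map_apply, surf, Measure.toSphere_apply' _ hpre, Measure.toSphere_apply' _ hs]
  congr 1
  have hL : MeasurePreserving L.toHomeomorph.toMeasurableEquiv (volume : Measure Ambient) volume :=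
    L.measurePreserving
  refine Eq.trans ?_ (hL.measure_preimage_equiv _)
  congr 1
  ext y
  simp only [Set.mem_preimage, Set.mem_smul, Set.mem_image, Subtype.exists]
  constructor
  · rintro ⟨r, hr, z, ⟨a, ha, hz, rfl⟩, rfl⟩
    exact ⟨r, hr, L a, ⟨L a, by simpa using ha, hz, rfl⟩, (map_smul L r a).symm⟩
  · rintro ⟨r, hr, z, ⟨a, ha, hz, rfl⟩, h⟩
    have h' : r • a = L y := h
    have ha' : L.symm a ∈ Metric.sphere (0 : Ambient) 1 := by simpa using ha
    have he : (sphereHomeo L).toMeasurableEquiv ⟨L.symm a, ha'⟩ = ⟨a, ha⟩ :=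
      Subtype.ext (L.apply_symm_apply a)
    refine ⟨r, hr, L.symm a, ⟨L.symm a, ha', ?_, rfl⟩, ?_⟩
    · rwa [he]
    · rw [← map_smul, h', L.symm_apply_apply]

theorem integral_sphereHomeo {E : Type*} [NormedAddCommGroup E] [NormedSpace ℝ E]
    (L : Ambient ≃ₗᵢ[ℝ] Ambient) (f : S3 → E) :
    ∫ x, f (sphereHomeo L x) ∂surf = ∫ x, f x ∂surf :=
  (measurePreserving_sphereHomeo L).integral_comp' f

theorem surf_real_univ : surf.real Set.univ = 2 * Real.pi ^ 2 := by
  rw [surf, Measure.toSphere_real_apply_univ, Measure.real, EuclideanSpace.volume_ball]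
  have : Real.Gamma ((4 : ℝ) / 2 + 1) = 2 := by
    rw [show (4 : ℝ) / 2 + 1 = ((2 : ℕ) : ℝ) + 1 by norm_num, Real.Gamma_nat_eq_factorial]; simp
  simp only [Fintype.card_fin, Nat.cast_ofNat, this, ENNReal.ofReal_one, one_pow, one_mul,
    finrank_euclideanSpace]
  rw [ENNReal.toReal_ofReal (by positivity), show Real.sqrt Real.pi ^ 4 = (Real.sqrt Real.pi ^ 2) ^ 2
    by ring, Real.sq_sqrt Real.pi_pos.le]
  ring

/-! ### The divergence theorem -/

/-- The `i`-th partial derivative of a function on `ℝ⁴`. -/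
noncomputable def pd (i : Fin 4) (φ : Ambient → ℝ) (x : Ambient) : ℝ :=
  fderiv ℝ φ x (EuclideanSpace.single i 1)

theorem gradient_coord (φ : Ambient → ℝ) (x : Ambient) (i : Fin 4) : (∇ φ x) i = pd i φ x := by
  rw [pd, ← inner_gradient_left, real_inner_comm, EuclideanSpace.inner_single_left]
  simp

theorem tangentGrad_coord (φ : Ambient → ℝ) (x : S3) (i : Fin 4) :
    tangentGrad φ x i
      = pd i φ x - (∑ j, (x : Ambient) j * pd j φ x) * (x : Ambient) i := by
  simp only [tangentGrad, PiLp.sub_apply, PiLp.smul_apply, gradient_coord, smul_eq_mul,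
    PiLp.inner_apply]
  simp [mul_comm]

theorem contDiff_pd {φ : Ambient → ℝ} (hφ : ContDiff ℝ ∞ φ) (i : Fin 4) :
    ContDiff ℝ ∞ (pd i φ) := by
  have : ContDiff ℝ ∞ (fderiv ℝ φ) := hφ.fderiv_right (by simp)
  exact this.clm_apply contDiff_const

theorem continuous_tangentGrad {φ : Ambient → ℝ} (hφ : ContDiff ℝ ∞ φ) :
    Continuous (tangentGrad φ) := by
  rw [show tangentGrad φ = fun x => WithLp.toLp 2 (fun i => tangentGrad φ x i) from rfl]
  simp only [tangentGrad_coord]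
  have h := fun i => (contDiff_pd hφ i).continuous
  fun_prop

theorem pd_mul {φ ψ : Ambient → ℝ} (hφ : ContDiff ℝ ∞ φ) (hψ : ContDiff ℝ ∞ ψ) (i : Fin 4)
    (x : Ambient) : pd i (fun y => φ y * ψ y) x = φ x * pd i ψ x + ψ x * pd i φ x := by
  have h1 := (hφ.differentiable (by simp) x).hasFDerivAt
  have h2 := (hψ.differentiable (by simp) x).hasFDerivAt
  rw [pd, show (fun y => φ y * ψ y) = φ * ψ from rfl, (h1.mul h2).fderiv]
  simp [pd]

theorem pd_coord (i j : Fin 4) (x : Ambient) :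
    pd i (fun y => y j) x = if i = j then 1 else 0 := by
  have h : HasFDerivAt (fun y : Ambient => y j) (EuclideanSpace.proj (𝕜 := ℝ) j) x :=
    (EuclideanSpace.proj (𝕜 := ℝ) j).hasFDerivAt
  rw [pd, h.fderiv]
  simp [eq_comm]

theorem contDiff_coord (j : Fin 4) : ContDiff ℝ ∞ (fun y : Ambient => y j) :=
  (EuclideanSpace.proj (𝕜 := ℝ) j).contDiff

theorem reflection_orthogonal_unit {w : Ambient} (hw : ‖w‖ = 1) (x : Ambient) :
    (ℝ ∙ w)ᗮ.reflection x = x - (2 * inner ℝ w x) • w := by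
  rw [Submodule.reflection_orthogonal_apply, Submodule.reflection_singleton_apply, hw]
  simp [two_smul, two_mul, add_smul]

/-- The infinitesimal rotations integrate to zero over the sphere. -/
theorem integral_rotation_field {Φ : Ambient → ℝ} (hΦ : ContDiff ℝ ∞ Φ) {i j : Fin 4}
    (hij : i ≠ j) :
    ∫ x : S3, ((x : Ambient) i * pd j Φ x - (x : Ambient) j * pd i Φ x) ∂surf = 0 := by
  -- The one-parameter family used is the reflection `S t` in the hyperplane orthogonal to the unit
  -- vector w(t), which turns in the (i,j)-plane. Each `S t` preserves the measure, so ∫ Φ(S t x)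
  -- does not depend on t.
  set w : ℝ → Ambient := fun t =>
    Real.cos t • EuclideanSpace.single i 1 + Real.sin t • EuclideanSpace.single j 1 with hw
  set w' : ℝ → Ambient := fun t =>
    -Real.sin t • EuclideanSpace.single i 1 + Real.cos t • EuclideanSpace.single j 1 with hw'
  have hwn : ∀ t, ‖w t‖ = 1 := fun t => by
    have : ‖w t‖ ^ 2 = 1 := by
      rw [hw, EuclideanSpace.norm_sq_eq, ← Finset.sum_subset (Finset.subset_univ {i, j}),
        Finset.sum_pair hij]
      · simp [hij, hij.symm]
      · intro k _ hk
        simp only [Finset.mem_insert, Finset.mem_singleton, not_or] at hk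
        simp [hk.1, hk.2]
    nlinarith [norm_nonneg (w t)]
  have hdw : ∀ t, HasDerivAt w (w' t) t := fun t =>
    ((Real.hasDerivAt_cos t).smul_const _).add ((Real.hasDerivAt_sin t).smul_const _)
  have hcw : Continuous w := by fun_prop
  have hcw' : Continuous w' := by fun_prop
  have hcΦ : Continuous (fderiv ℝ Φ) := hΦ.continuous_fderiv (by simp)
  have hcΦ0 := hΦ.continuous
  set S : ℝ → S3 → Ambient := fun t x => (x : Ambient) - (2 * inner ℝ (w t) (x : Ambient)) • w t
    with hS
  set S' : ℝ → S3 → Ambient := fun t x =>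
    -((2 * inner ℝ (w t) (x : Ambient)) • w' t + (2 * inner ℝ (w' t) (x : Ambient)) • w t) with hS'
  have hdS : ∀ t x, HasDerivAt (fun t => S t x) (S' t x) t := fun t x => by
    have h1 : HasDerivAt (fun t => inner ℝ (w t) (x : Ambient)) (inner ℝ (w' t) (x : Ambient)) t := by
      simpa using (hdw t).inner ℝ (hasDerivAt_const t (x : Ambient))
    simpa [hS, hS'] using ((h1.const_mul 2).smul (hdw t)).const_sub (x : Ambient)
  have hcF : Continuous (fun p : ℝ × S3 => fderiv ℝ Φ (S p.1 p.2) (S' p.1 p.2)) := by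
    have a : Continuous fun p : ℝ × S3 => S p.1 p.2 := by
      simp only [hS]; fun_prop
    have b : Continuous fun p : ℝ × S3 => S' p.1 p.2 := by
      simp only [hS']; fun_prop
    exact (hcΦ.comp a).clm_apply b
  obtain ⟨C, hC⟩ := (isCompact_Icc.prod isCompact_univ : IsCompact
    (Set.Icc (-1 : ℝ) 1 ×ˢ (Set.univ : Set S3))).exists_bound_of_continuousOn hcF.continuousOn
  have hcS : ∀ t, Continuous (S t) := fun t => by simp only [hS]; fun_prop
  have key := (hasDerivAt_integral_of_dominated_loc_of_deriv_le (μ := surf) (𝕜 := ℝ)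
    (F := fun t x => Φ (S t x)) (F' := fun t x => fderiv ℝ Φ (S t x) (S' t x)) (x₀ := 0)
    (s := Set.Icc (-1) 1) (bound := fun _ => C) (Icc_mem_nhds (by norm_num) (by norm_num))
    (Eventually.of_forall fun t => (hcΦ0.comp (hcS t)).aestronglyMeasurable)
    (integrable_of_continuous (hcΦ0.comp (hcS 0)))
    (hcF.comp (Continuous.prodMk_right (0 : ℝ))).aestronglyMeasurable
    (Eventually.of_forall fun x t ht => hC (t, x) ⟨ht, trivial⟩)
    (integrable_const C)
    (Eventually.of_forall fun x t _ =>
      ((hΦ.differentiable (by simp) (S t x)).hasFDerivAt.comp_hasDerivAt t (hdS t x)))).2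
  have hconst : (fun t => ∫ x, Φ (S t x) ∂surf) = fun _ => ∫ x : S3, Φ x ∂surf := by
    funext t
    rw [← integral_sphereHomeo ((ℝ ∙ w t)ᗮ.reflection) (fun x : S3 => Φ x)]
    simp only [coe_sphereHomeo, reflection_orthogonal_unit (hwn t), hS]
  rw [hconst] at key
  have h0 := key.unique (hasDerivAt_const _ _)
  have hw0 : w 0 = EuclideanSpace.single i 1 := by simp [hw]
  have hw0' : w' 0 = EuclideanSpace.single j 1 := by simp [hw']
  -- The substitution x ↦ S 0 x turns the derivative at t = 0 into the rotation field. The factor 2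
  -- appears because S t ∘ S 0 rotates by twice the angle of w(t).
  rw [← integral_sphereHomeo ((ℝ ∙ w 0)ᗮ.reflection)] at h0
  have h2 : ∀ x : S3, fderiv ℝ Φ (S 0 (sphereHomeo ((ℝ ∙ w 0)ᗮ.reflection) x))
      (S' 0 (sphereHomeo ((ℝ ∙ w 0)ᗮ.reflection) x)) =
      2 * ((x : Ambient) i * pd j Φ x - (x : Ambient) j * pd i Φ x) := fun x => by
    have e1 : S 0 (sphereHomeo ((ℝ ∙ w 0)ᗮ.reflection) x) = x := by
      simp only [hS]
      rw [← reflection_orthogonal_unit (hwn 0), coe_sphereHomeo, Submodule.reflection_reflection]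
    rw [e1]
    simp only [hS', coe_sphereHomeo, reflection_orthogonal_unit (hwn 0)]
    rw [hw0, hw0']
    simp only [map_neg, map_add, map_smul, smul_eq_mul, inner_sub_right, inner_smul_right,
      EuclideanSpace.inner_single_left, pd]
    simp [hij.symm]
    ring
  simp only [h2] at h0
  rw [integral_const_mul] at h0
  linarith

theorem integral_coord {F : S3 → Ambient} (hF : Integrable F surf) (i : Fin 4) :
    (∫ x, F x ∂surf) i = ∫ x, F x i ∂surf :=
  ((EuclideanSpace.proj (𝕜 := ℝ) i).integral_comp_comm hF).symm

/-- The divergence theorem on the sphere. -/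
theorem integral_tangentGrad_coord {Φ : Ambient → ℝ} (hΦ : ContDiff ℝ ∞ Φ) (i : Fin 4) :
    ∫ x, tangentGrad Φ x i ∂surf = ∫ x : S3, 3 * Φ x * (x : Ambient) i ∂surf := by
  -- On |x| = 1 the sum over j of (x_i ∂_j - x_j ∂_i)(x_j Φ) equals 3Φx_i minus the i-th tangential
  -- derivative; the 3 is 4 - 1.
  have hrot : ∀ j : Fin 4, ∫ x : S3, ((x : Ambient) i * pd j (fun y => y j * Φ y) x
      - (x : Ambient) j * pd i (fun y => y j * Φ y) x) ∂surf = 0 := fun j => by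
    rcases eq_or_ne i j with rfl | hij
    · simp
    · exact integral_rotation_field ((contDiff_coord j).mul hΦ) hij
  have hc := fun k => (contDiff_pd hΦ k).continuous
  have hcΦ := hΦ.continuous
  have hsum : ∫ x : S3, ∑ j : Fin 4, ((x : Ambient) i * pd j (fun y => y j * Φ y) x
      - (x : Ambient) j * pd i (fun y => y j * Φ y) x) ∂surf = 0 := by
    rw [integral_finsetSum]
    · simp [hrot]
    · intro j _
      have := fun k => (contDiff_pd ((contDiff_coord j).mul hΦ) k).continuous
      exact integrable_of_continuous (by fun_prop)
  have e : ∀ x : S3, ∑ j : Fin 4, ((x : Ambient) i * pd j (fun y => y j * Φ y) x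
      - (x : Ambient) j * pd i (fun y => y j * Φ y) x)
      = 3 * Φ x * (x : Ambient) i - tangentGrad Φ x i := fun x => by
    simp only [pd_mul (contDiff_coord _) hΦ, pd_coord, tangentGrad_coord]
    have hx := sum_sq_coord x
    rw [Fin.sum_univ_four, Fin.sum_univ_four]
    fin_cases i <;> simp
    · linear_combination (-(pd 0 Φ (x : Ambient))) * hx
    · linear_combination (-(pd 1 Φ (x : Ambient))) * hx
    · linear_combination (-(pd 2 Φ (x : Ambient))) * hx
    · linear_combination (-(pd 3 Φ (x : Ambient))) * hx
  simp only [e] at hsum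
  rw [integral_sub, sub_eq_zero] at hsum
  · exact hsum.symm
  · exact integrable_of_continuous (by fun_prop)
  · have := continuous_tangentGrad hΦ
    exact integrable_of_continuous (by fun_prop)

theorem tangentGrad_mul {φ ψ : Ambient → ℝ} (hφ : ContDiff ℝ ∞ φ) (hψ : ContDiff ℝ ∞ ψ) (x : S3)
    (i : Fin 4) : tangentGrad (fun y => φ y * ψ y) x i
      = φ x * tangentGrad ψ x i + ψ x * tangentGrad φ x i := by
  simp only [tangentGrad_coord, pd_mul hφ hψ, Fin.sum_univ_four]
  ring

/-- The tangential gradient of a smooth function is a weak gradient. -/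
theorem hasWeakGrad_of_contDiff {ψ : Ambient → ℝ} (hψ : ContDiff ℝ ∞ ψ) :
    HasWeakGrad (fun x => ψ x) (tangentGrad ψ) := by
  intro φ hφ
  have cψ := hψ.continuous
  have cφ := hφ.continuous
  have gψ := continuous_tangentGrad hψ
  have gφ := continuous_tangentGrad hφ
  ext i
  rw [integral_coord (integrable_of_continuous (by fun_prop)),
    integral_coord (integrable_of_continuous (by fun_prop))]
  have h := integral_tangentGrad_coord (hφ.mul hψ) i
  simp only [tangentGrad_mul hφ hψ] at h
  rw [integral_add (integrable_of_continuous (by fun_prop))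
    (integrable_of_continuous (by fun_prop))] at h
  simp only [PiLp.smul_apply, PiLp.add_apply, smul_eq_mul, neg_mul]
  rw [integral_add (integrable_of_continuous (by fun_prop))
    (integrable_of_continuous (by fun_prop)), integral_neg]
  have e : ∫ x : S3, 3 * (φ x * ψ x) * (x : Ambient) i ∂surf
      = ∫ x : S3, 3 * ψ x * φ x * (x : Ambient) i ∂surf := by
    congr 1; funext x; ring
  linarith

/-! ### Zonal functions and weak identities -/

theorem memLp_of_continuous {E : Type*} [NormedAddCommGroup E] {f : S3 → E}
    (hf : Continuous f) : MemLp f 2 surf :=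
  hf.memLp_of_hasCompactSupport (HasCompactSupport.of_compactSpace f)

/-- The function `x ↦ f(⟨ξ, x⟩)` on `ℝ⁴`. -/
noncomputable def zonalExt (ξ : S3) (f : ℝ[X]) (x : Ambient) : ℝ :=
  f.eval (inner ℝ (ξ : Ambient) x)

/-- The zonal function `x ↦ f(⟨ξ, x⟩)` on the sphere. -/
noncomputable def zonal (ξ : S3) (f : ℝ[X]) (x : S3) : ℝ :=
  f.eval (inner ℝ (ξ : Ambient) (x : Ambient))

/-- The `i`-th coordinate of the tangential gradient of a zonal function, extended to `ℝ⁴`. -/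
noncomputable def zonalField (ξ : S3) (f : ℝ[X]) (i : Fin 4) (x : Ambient) : ℝ :=
  zonalExt ξ (derivative f) x * ((ξ : Ambient) i - zonalExt ξ X x * x i)

/-- The Laplace-Beltrami operator on zonal functions. -/
noncomputable def zonalLaplacian (f : ℝ[X]) : ℝ[X] :=
  (1 - X ^ 2) * derivative (derivative f) - 3 * X * derivative f

theorem contDiff_zonalExt (ξ : S3) (f : ℝ[X]) : ContDiff ℝ ∞ (zonalExt ξ f) := by
  have h : ContDiff ℝ ∞ (fun x : Ambient => inner ℝ (ξ : Ambient) x) :=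
    contDiff_const.inner ℝ contDiff_id
  have hf : ContDiff ℝ ∞ (fun t : ℝ => f.eval t) := by
    simpa using f.contDiff_aeval (𝕜 := ℝ) ∞
  exact hf.comp h

theorem continuous_zonal (ξ : S3) (f : ℝ[X]) : Continuous (zonal ξ f) :=
  (contDiff_zonalExt ξ f).continuous.comp continuous_subtype_val

theorem contDiff_zonalField (ξ : S3) (f : ℝ[X]) (i : Fin 4) :
    ContDiff ℝ ∞ (zonalField ξ f i) :=
  (contDiff_zonalExt ξ _).mul
    (contDiff_const.sub ((contDiff_zonalExt ξ X).mul (contDiff_coord i)))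

theorem pd_zonalExt (ξ : S3) (f : ℝ[X]) (i : Fin 4) (x : Ambient) :
    pd i (zonalExt ξ f) x = zonalExt ξ (derivative f) x * (ξ : Ambient) i := by
  have h1 : HasFDerivAt (fun x : Ambient => inner ℝ (ξ : Ambient) x) (innerSL ℝ (ξ : Ambient)) x :=
    (innerSL ℝ (ξ : Ambient)).hasFDerivAt
  have h2 := (f.hasDerivAt (inner ℝ (ξ : Ambient) x)).comp_hasFDerivAt x h1
  have h3 : HasFDerivAt (zonalExt ξ f) _ x := h2
  rw [pd, h3.fderiv]
  simp [zonalExt, EuclideanSpace.inner_single_right]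

theorem pd_sub {φ ψ : Ambient → ℝ} (hφ : ContDiff ℝ ∞ φ) (hψ : ContDiff ℝ ∞ ψ) (i : Fin 4)
    (x : Ambient) : pd i (fun y => φ y - ψ y) x = pd i φ x - pd i ψ x := by
  have h1 := (hφ.differentiable (by simp) x).hasFDerivAt
  have h2 := (hψ.differentiable (by simp) x).hasFDerivAt
  rw [pd, show (fun y => φ y - ψ y) = φ - ψ from rfl, (h1.sub h2).fderiv]
  simp [pd]

theorem pd_const (c : ℝ) (i : Fin 4) (x : Ambient) : pd i (fun _ => c) x = 0 := by
  simp [pd]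

theorem pd_zonalField (ξ : S3) (f : ℝ[X]) (i j : Fin 4) (x : Ambient) :
    pd j (zonalField ξ f i) x
      = zonalExt ξ (derivative (derivative f)) x * (ξ : Ambient) j *
          ((ξ : Ambient) i - inner ℝ (ξ : Ambient) x * x i)
        - zonalExt ξ (derivative f) x * ((ξ : Ambient) j * x i
          + inner ℝ (ξ : Ambient) x * if j = i then 1 else 0) := by
  unfold zonalField
  rw [pd_mul (contDiff_zonalExt ξ _)
    (contDiff_const.sub ((contDiff_zonalExt ξ X).mul (contDiff_coord i))),
    pd_sub contDiff_const ((contDiff_zonalExt ξ X).mul (contDiff_coord i)),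
    pd_mul (contDiff_zonalExt ξ X) (contDiff_coord i), pd_const, pd_coord, pd_zonalExt, pd_zonalExt]
  simp only [zonalExt, derivative_X, eval_one, eval_X]
  ring

theorem inner_coord (x y : Ambient) :
    inner ℝ x y = x 0 * y 0 + x 1 * y 1 + x 2 * y 2 + x 3 * y 3 := by
  simp [PiLp.inner_apply, Fin.sum_univ_four, mul_comm]

theorem tangentGrad_zonalExt (ξ : S3) (f : ℝ[X]) (x : S3) (i : Fin 4) :
    tangentGrad (zonalExt ξ f) x i = zonalField ξ f i x := by
  simp only [tangentGrad_coord, pd_zonalExt, zonalField, Fin.sum_univ_four]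
  simp only [zonalExt, eval_X, inner_coord]
  ring

theorem sum_zonalField_mul_coord (ξ : S3) (f : ℝ[X]) (x : S3) :
    ∑ i, zonalField ξ f i x * (x : Ambient) i = 0 := by
  simp only [zonalField, Fin.sum_univ_four, zonalExt, eval_X]
  generalize (derivative f).eval _ = a
  have hx := sum_sq_coord x
  have ht := inner_coord (ξ : Ambient) (x : Ambient)
  generalize inner ℝ (ξ : Ambient) (x : Ambient) = t at *
  linear_combination (-a * t) * hx - a * ht

theorem sum_tangentGrad_zonalField (ξ : S3) (f : ℝ[X]) (x : S3) :
    ∑ i, tangentGrad (zonalField ξ f i) x i = zonal ξ (zonalLaplacian f) x := by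
  simp only [tangentGrad_coord, pd_zonalField, zonal, zonalLaplacian, Fin.sum_univ_four]
  simp only [zonalExt, eval_X, eval_sub, eval_mul, eval_pow, eval_one, eval_ofNat]
  generalize (derivative f).eval _ = a
  generalize (derivative (derivative f)).eval _ = b
  have hx := sum_sq_coord x
  have hξ := sum_sq_coord ξ
  have ht := inner_coord (ξ : Ambient) (x : Ambient)
  generalize inner ℝ (ξ : Ambient) (x : Ambient) = t at *
  simp
  linear_combination b * hξ + (b * t + a) * ((ξ : Ambient) 0 * (x : Ambient) 0
    + (ξ : Ambient) 1 * (x : Ambient) 1 + (ξ : Ambient) 2 * (x : Ambient) 2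
    + (ξ : Ambient) 3 * (x : Ambient) 3) * hx + a * t * hx
    + b * (t + (ξ : Ambient) 0 * (x : Ambient) 0
    + (ξ : Ambient) 1 * (x : Ambient) 1 + (ξ : Ambient) 2 * (x : Ambient) 2
    + (ξ : Ambient) 3 * (x : Ambient) 3) * ht

/-- The definition of a weak gradient, tested in coordinates. -/
theorem HasWeakGrad.integral_coord {u : S3 → ℝ} {g : S3 → Ambient} (hw : HasWeakGrad u g)
    (hu : Integrable u surf) (hg : ∀ i, Integrable (fun x => g x i) surf) {φ : Ambient → ℝ}
    (hφ : ContDiff ℝ ∞ φ) (i : Fin 4) :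
    ∫ x, u x * tangentGrad φ x i ∂surf
      = -∫ x, g x i * φ x ∂surf + 3 * ∫ x : S3, u x * (φ x * (x : Ambient) i) ∂surf := by
  have cφ := hφ.continuous
  have gφ := continuous_tangentGrad hφ
  have hvec : ∀ {F : S3 → Ambient}, (∀ j, Integrable (fun x => F x j) surf) →
      Integrable F surf := fun h => Integrable.of_eval_piLp h
  have i1 : ∀ j, Integrable (fun x => u x * tangentGrad φ x j) surf := fun j =>
    integrable_mul_continuous hu (by fun_prop)
  have i2 : ∀ j, Integrable (fun x : S3 => g x j * φ x) surf := fun j =>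
    integrable_mul_continuous (hg j) (by fun_prop)
  have i3 : ∀ j, Integrable (fun x : S3 => u x * (φ x * (x : Ambient) j)) surf := fun j =>
    integrable_mul_continuous hu (by fun_prop)
  have h := congrArg (fun v : Ambient => v i) (hw φ hφ)
  have e : ∀ (x : S3) (j : Fin 4), (-(φ (x : Ambient)) • g x
      + (3 * u x * φ (x : Ambient)) • (x : Ambient)) j
      = -(g x j * φ x) + 3 * (u x * (φ x * (x : Ambient) j)) := fun x j => by
    simp; ring
  simp only at h
  rw [ThreeSphere.integral_coord (hvec i1), ThreeSphere.integral_coord (hvec fun j => by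
    simp only [e]; exact (i2 j).neg.add ((i3 j).const_mul 3))] at h
  simp only [e] at h
  rw [integral_add (f := fun x => -(g x i * φ x)) (i2 i).neg ((i3 i).const_mul 3), integral_neg,
    integral_const_mul] at h
  exact h

/-! ### Integration by parts of H² functions against zonal functions -/

section H2

variable {u : S3 → ℝ} {g : S3 → Ambient} {h : Fin 4 → S3 → Ambient}

theorem memLp_coord {F : S3 → Ambient} (hF : MemLp F 2 surf) (i : Fin 4) :
    MemLp (fun x => F x i) 2 surf :=
  (EuclideanSpace.proj (𝕜 := ℝ) i).comp_memLp' hF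

theorem IsH2.memLp_laplacian (H : IsH2 u g h) : MemLp (laplacian h) 2 surf :=
  memLp_finsetSum _ fun i _ => memLp_coord (H.memLp_hess i) i

theorem IsH2.integrable (H : IsH2 u g h) : Integrable u surf :=
  H.memLp.integrable (by norm_num)

theorem IsH2.integrable_grad (H : IsH2 u g h) (i : Fin 4) : Integrable (fun x => g x i) surf :=
  (memLp_coord H.memLp_grad i).integrable (by norm_num)

theorem IsH2.integrable_hess (H : IsH2 u g h) (i j : Fin 4) :
    Integrable (fun x => h i x j) surf :=
  (memLp_coord (H.memLp_hess i) j).integrable (by norm_num)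

/-- The i-th component of the weak identity is tested with the i-th component of the zonal gradient
field, and the results are added. The curvature term drops out because the field is tangent, and its
divergence is the zonal Laplacian. -/
theorem IsH2.integral_mul_zonalLaplacian_eq_grad (H : IsH2 u g h) (ξ : S3) (f : ℝ[X]) :
    ∫ x, u x * zonal ξ (zonalLaplacian f) x ∂surf
      = -∫ x, ∑ i, g x i * zonalField ξ f i x ∂surf := by
  have cf : ∀ i, Continuous (fun x : S3 => zonalField ξ f i x) := fun i =>
    (contDiff_zonalField ξ f i).continuous.comp continuous_subtype_val
  have hi := fun i => H.weakGrad.integral_coord H.integrable H.integrable_grad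
    (contDiff_zonalField ξ f i) i
  have ig : ∀ i, Integrable (fun x : S3 => g x i * zonalField ξ f i x) surf := fun i =>
    integrable_mul_continuous (H.integrable_grad i) (cf i)
  have it : ∀ i, Integrable (fun x : S3 => u x * tangentGrad (zonalField ξ f i) x i) surf :=
    fun i => integrable_mul_continuous H.integrable (by
      have := continuous_tangentGrad (contDiff_zonalField ξ f i)
      fun_prop)
  have iu : ∀ i, Integrable (fun x : S3 => u x * (zonalField ξ f i x * (x : Ambient) i)) surf :=
    fun i => integrable_mul_continuous H.integrable ((cf i).mul (by fun_prop))
  have s1 : ∫ x, u x * zonal ξ (zonalLaplacian f) x ∂surf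
      = ∑ i, ∫ x, u x * tangentGrad (zonalField ξ f i) x i ∂surf := by
    rw [← integral_finsetSum _ fun i _ => it i]
    simp only [← Finset.mul_sum, sum_tangentGrad_zonalField]
  have s2 : ∑ i, ∫ x : S3, u x * (zonalField ξ f i x * (x : Ambient) i) ∂surf = 0 := by
    rw [← integral_finsetSum _ fun i _ => iu i]
    simp only [← Finset.mul_sum, sum_zonalField_mul_coord]
    simp
  rw [s1, integral_finsetSum _ fun i _ => ig i]
  simp only [hi, Finset.sum_add_distrib, ← Finset.mul_sum, s2, Finset.sum_neg_distrib]
  simp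

/-- A weak gradient is tangent to the sphere, tested against smooth functions. -/
theorem IsH2.integral_grad_mul_coord (H : IsH2 u g h) {φ : Ambient → ℝ} (hφ : ContDiff ℝ ∞ φ) :
    ∑ i, ∫ x : S3, g x i * (φ x * (x : Ambient) i) ∂surf = 0 := by
  have cφ := hφ.continuous
  have cg := continuous_tangentGrad hφ
  have hi := fun i => H.weakGrad.integral_coord H.integrable H.integrable_grad
    (hφ.mul (contDiff_coord i)) i
  have i1 : ∀ i, Integrable
      (fun x : S3 => u x * tangentGrad (fun y => φ y * y i) x i) surf := fun i => by
    have := continuous_tangentGrad (hφ.mul (contDiff_coord i))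
    exact integrable_mul_continuous H.integrable (by fun_prop)
  have i2 : ∀ i, Integrable
      (fun x : S3 => u x * (φ x * (x : Ambient) i * (x : Ambient) i)) surf := fun i =>
    integrable_mul_continuous H.integrable (by fun_prop)
  -- The tangential divergence of φx is 3φ, so both sides of the weak identity contain 3∫uφ, and
  -- only the normal component of g is left.
  have s1 : ∑ i, ∫ x, u x * tangentGrad (fun y => φ y * y i) x i ∂surf
      = 3 * ∫ x : S3, u x * φ x ∂surf := by
    rw [← integral_finsetSum _ fun i _ => i1 i, ← integral_const_mul]
    congr 1
    funext x
    rw [← Finset.mul_sum]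
    simp only [tangentGrad_mul hφ (contDiff_coord _)]
    have hx := sum_sq_coord x
    simp only [tangentGrad_coord, pd_coord, Fin.sum_univ_four]
    simp
    linear_combination (-(u x * φ x) - u x * ((x : Ambient) 0 * pd 0 φ x
      + (x : Ambient) 1 * pd 1 φ x + (x : Ambient) 2 * pd 2 φ x
      + (x : Ambient) 3 * pd 3 φ x)) * hx
  have s2 : ∑ i, ∫ x : S3, u x * (φ x * (x : Ambient) i * (x : Ambient) i) ∂surf
      = ∫ x : S3, u x * φ x ∂surf := by
    rw [← integral_finsetSum _ fun i _ => i2 i]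
    congr 1
    funext x
    rw [Fin.sum_univ_four]
    linear_combination (u x * φ x) * sum_sq_coord x
  have hs : ∑ i, ∫ x, u x * tangentGrad (fun y => φ y * y i) x i ∂surf = _ :=
    Finset.sum_congr rfl fun i _ => hi i
  rw [Finset.sum_add_distrib, ← Finset.mul_sum, s1, s2, Finset.sum_neg_distrib] at hs
  linarith

/-- Two integrations by parts: the rows of the weak Hessian are tested with f, the curvature term
vanishes because g is tangent, and the previous identity moves the second derivative. -/
theorem IsH2.integral_laplacian_mul_zonal (H : IsH2 u g h) (ξ : S3) (f : ℝ[X]) :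
    ∫ x, laplacian h x * zonal ξ f x ∂surf = ∫ x, u x * zonal ξ (zonalLaplacian f) x ∂surf := by
  have cf := contDiff_zonalExt ξ f
  have hi := fun i => (H.weakHess i).integral_coord (H.integrable_grad i)
    (H.integrable_hess i) cf i
  have i1 : ∀ i, Integrable (fun x : S3 => h i x i * zonalExt ξ f x) surf := fun i =>
    integrable_mul_continuous (H.integrable_hess i i) (cf.continuous.comp continuous_subtype_val)
  have i2 : ∀ i, Integrable (fun x : S3 => g x i * zonalField ξ f i x) surf := fun i =>
    integrable_mul_continuous (H.integrable_grad i)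
      ((contDiff_zonalField ξ f i).continuous.comp continuous_subtype_val)
  have hs : ∑ i, ∫ x, g x i * tangentGrad (zonalExt ξ f) x i ∂surf = _ :=
    Finset.sum_congr rfl fun i _ => hi i
  rw [Finset.sum_add_distrib, ← Finset.mul_sum, H.integral_grad_mul_coord cf,
    Finset.sum_neg_distrib] at hs
  simp only [tangentGrad_zonalExt] at hs
  rw [← integral_finsetSum _ fun i _ => i2 i, ← integral_finsetSum _ fun i _ => i1 i] at hs
  rw [H.integral_mul_zonalLaplacian_eq_grad, hs]
  simp only [laplacian, Finset.sum_mul, zonal, zonalExt]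
  ring

end H2

/-! ### Zonal polynomials as elements of H² -/

theorem isH2_zonal (ξ : S3) (f : ℝ[X]) :
    IsH2 (zonal ξ f) (tangentGrad (zonalExt ξ f)) (fun i => tangentGrad (zonalField ξ f i)) where
  memLp := memLp_of_continuous (continuous_zonal ξ f)
  memLp_grad := memLp_of_continuous (continuous_tangentGrad (contDiff_zonalExt ξ f))
  memLp_hess i := memLp_of_continuous (continuous_tangentGrad (contDiff_zonalField ξ f i))
  weakGrad := hasWeakGrad_of_contDiff (contDiff_zonalExt ξ f)
  weakHess i := by
    simpa only [tangentGrad_zonalExt] using hasWeakGrad_of_contDiff (contDiff_zonalField ξ f i)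

theorem laplacian_zonal (ξ : S3) (f : ℝ[X]) (x : S3) :
    laplacian (fun i => tangentGrad (zonalField ξ f i)) x = zonal ξ (zonalLaplacian f) x :=
  sum_tangentGrad_zonalField ξ f x

theorem integral_norm_tangentGrad_zonal (ξ : S3) (f : ℝ[X]) :
    ∫ x, ‖tangentGrad (zonalExt ξ f) x‖ ^ 2 ∂surf
      = -∫ x, zonal ξ f x * zonal ξ (zonalLaplacian f) x ∂surf := by
  rw [(isH2_zonal ξ f).integral_mul_zonalLaplacian_eq_grad, neg_neg]
  congr 1
  funext x
  rw [EuclideanSpace.norm_sq_eq]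
  simp [tangentGrad_zonalExt, sq]

/-! ### Zonal harmonics -/

/-- The Chebyshev polynomials of the second kind, which give the zonal harmonics on `𝕊³`. -/
noncomputable def cheb (n : ℕ) : ℝ[X] := Polynomial.Chebyshev.U ℝ n

/-- The `n`-th eigenvalue of `-Δ` on `𝕊³`. -/
noncomputable def eigen (n : ℕ) : ℝ := n * (n + 2)

theorem eigen_nonneg (n : ℕ) : 0 ≤ eigen n := by unfold eigen; positivity

theorem eigen_zero : eigen 0 = 0 := by simp [eigen]

theorem three_le_eigen {n : ℕ} (hn : n ≠ 0) : 3 ≤ eigen n := by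
  have : (1 : ℝ) ≤ n := by exact_mod_cast Nat.one_le_iff_ne_zero.2 hn
  unfold eigen
  nlinarith

theorem eigen_injective : Function.Injective eigen := fun m n h => by
  unfold eigen at h
  have h2 : ((m : ℝ) - n) * (m + n + 2) = 0 := by linear_combination h
  rcases mul_eq_zero.1 h2 with h3 | h3
  · exact_mod_cast sub_eq_zero.1 h3
  · have : (0 : ℝ) < m + n + 2 := by positivity
    linarith

theorem integral_const_surf (c : ℝ) : ∫ _ : S3, c ∂surf = 2 * Real.pi ^ 2 * c := by
  rw [integral_const, surf_real_univ, smul_eq_mul]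

theorem cheb_zero : cheb 0 = 1 := by simp [cheb]

theorem cheb_one : cheb 1 = 2 * X := by simp [cheb]

theorem cheb_add_two (n : ℕ) : cheb (n + 2) = 2 * X * cheb (n + 1) - cheb n := by
  have := Polynomial.Chebyshev.U_add_two ℝ (n : ℤ)
  simpa only [cheb, Nat.cast_add, Nat.cast_ofNat, Nat.cast_one] using this

theorem eval_cheb_add_two (n : ℕ) (t : ℝ) :
    (cheb (n + 2)).eval t = 2 * t * (cheb (n + 1)).eval t - (cheb n).eval t := by
  simp [cheb_add_two]

theorem cheb_eval_one (n : ℕ) : (cheb n).eval 1 = n + 1 := by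
  simp [cheb]

theorem zonalLaplacian_cheb (n : ℕ) : zonalLaplacian (cheb n) = C (-eigen n) * cheb n := by
  have h := Polynomial.Chebyshev.one_sub_X_sq_mul_derivative_derivative_U_eq_poly_in_U (R := ℝ) n
  simp only [Function.iterate_succ, Function.iterate_zero, Function.comp_apply, id_eq] at h
  have e : (C (-eigen n) : ℝ[X]) = -((n + 2) * n) := by
    simp only [eigen, map_neg, map_mul, map_add, map_natCast, map_ofNat]
    ring
  rw [zonalLaplacian, cheb, h, e]
  push_cast
  ring

theorem abs_eval_cheb_le (n : ℕ) {t : ℝ} (ht : |t| ≤ 1) : |(cheb n).eval t| ≤ n + 1 := by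
  induction n with
  | zero => simp [cheb_zero]
  | succ n ih =>
    have h := Polynomial.Chebyshev.U_eq_X_mul_U_add_T ℝ (n : ℤ)
    have h1 : (cheb (n + 1)).eval t
        = t * (cheb n).eval t + (Polynomial.Chebyshev.T ℝ ((n : ℤ) + 1)).eval t := by
      simp [cheb, h]
    have h2 : |(Polynomial.Chebyshev.T ℝ ((n : ℤ) + 1)).eval t| ≤ 1 :=
      Polynomial.Chebyshev.abs_eval_T_real_le_one _ ht
    rw [h1]
    push_cast
    calc _ ≤ |t| * |(cheb n).eval t| + |(Polynomial.Chebyshev.T ℝ ((n : ℤ) + 1)).eval t| := by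
          rw [← abs_mul]; exact abs_add_le _ _
      _ ≤ 1 * (n + 1) + 1 := by gcongr
      _ = _ := by ring

theorem abs_inner_le_one (ξ x : S3) : |inner ℝ (ξ : Ambient) (x : Ambient)| ≤ 1 := by
  simpa using abs_real_inner_le_norm (ξ : Ambient) (x : Ambient)

theorem zonal_add (ξ : S3) (f p : ℝ[X]) (x : S3) :
    zonal ξ (f + p) x = zonal ξ f x + zonal ξ p x := by
  simp [zonal]

theorem zonal_C_mul (ξ : S3) (a : ℝ) (p : ℝ[X]) (x : S3) :
    zonal ξ (C a * p) x = a * zonal ξ p x := by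
  simp [zonal]

theorem zonal_mul (ξ : S3) (f p : ℝ[X]) (x : S3) :
    zonal ξ (f * p) x = zonal ξ f x * zonal ξ p x := by
  simp [zonal]

theorem zonal_sum {ι : Type*} (ξ : S3) (s : Finset ι) (f : ι → ℝ[X]) (x : S3) :
    zonal ξ (∑ i ∈ s, f i) x = ∑ i ∈ s, zonal ξ (f i) x := by
  simp [zonal, eval_finsetSum]

theorem abs_zonal_cheb_le (ξ : S3) (n : ℕ) (x : S3) : |zonal ξ (cheb n) x| ≤ n + 1 :=
  abs_eval_cheb_le n (abs_inner_le_one ξ x)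

/-- Eigenfunctions of a symmetric operator with distinct eigenvalues are orthogonal; no integration
over slices of the sphere is needed. -/
theorem integral_zonal_cheb_of_ne (ξ : S3) {m n : ℕ} (hmn : m ≠ n) :
    ∫ x, zonal ξ (cheb m) x * zonal ξ (cheb n) x ∂surf = 0 := by
  have h := (isH2_zonal ξ (cheb m)).integral_laplacian_mul_zonal ξ (cheb n)
  simp only [laplacian_zonal, zonalLaplacian_cheb, zonal_C_mul] at h
  rw [show (fun x => -eigen m * zonal ξ (cheb m) x * zonal ξ (cheb n) x)
      = fun x => -eigen m * (zonal ξ (cheb m) x * zonal ξ (cheb n) x) by ext; ring,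
    show (fun x => zonal ξ (cheb m) x * (-eigen n * zonal ξ (cheb n) x))
      = fun x => -eigen n * (zonal ξ (cheb m) x * zonal ξ (cheb n) x) by ext; ring,
    integral_const_mul, integral_const_mul] at h
  have h2 : (eigen m - eigen n) * ∫ x, zonal ξ (cheb m) x * zonal ξ (cheb n) x ∂surf = 0 := by
    linear_combination -h
  exact (mul_eq_zero.1 h2).resolve_left (sub_ne_zero.2 (eigen_injective.ne hmn))

/-- It reduces the norm of U_{n+1} to the total mass, since the product on the right integrates to
zero by orthogonality. -/
theorem cheb_sq (n : ℕ) : cheb (n + 1) ^ 2 = 1 + cheb (n + 2) * cheb n := by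
  induction n with
  | zero => rw [cheb_add_two, cheb_zero, zero_add, cheb_one]; ring
  | succ n ih =>
    rw [cheb_add_two (n + 1)]
    have h2 := cheb_add_two n
    linear_combination ih + cheb (n + 2) * h2

theorem integral_zonal_cheb_sq (ξ : S3) (n : ℕ) :
    ∫ x, zonal ξ (cheb n) x * zonal ξ (cheb n) x ∂surf = 2 * Real.pi ^ 2 := by
  rcases n with _ | n
  · simpa only [zonal, cheb_zero, eval_one, mul_one] using integral_const_surf 1
  · have h : ∀ x, zonal ξ (cheb (n + 1)) x * zonal ξ (cheb (n + 1)) x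
        = 1 + zonal ξ (cheb (n + 2)) x * zonal ξ (cheb n) x := fun x => by
      rw [← zonal_mul, ← zonal_mul, ← sq, cheb_sq, zonal_add]
      simp [zonal]
    simp only [h]
    rw [integral_add (g := fun x => zonal ξ (cheb (n + 2)) x * zonal ξ (cheb n) x)
      (integrable_const _) (integrable_of_continuous
      ((continuous_zonal _ _).mul (continuous_zonal _ _))), integral_zonal_cheb_of_ne ξ (by omega),
      integral_const_surf]
    ring

/-! ### The Poisson kernel -/

/-- The Poisson kernel of the four-dimensional ball, as a function of `t = ⟨ξ, x⟩`. -/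
noncomputable def poisson (r t : ℝ) : ℝ := (1 - r ^ 2) / (1 - 2 * r * t + r ^ 2) ^ 2

theorem poisson_nonneg {r : ℝ} (h0 : 0 ≤ r) (h1 : r < 1) (t : ℝ) : 0 ≤ poisson r t := by
  unfold poisson
  have : 0 ≤ 1 - r ^ 2 := by nlinarith
  positivity

theorem summable_add_one_sq_mul_pow {r : ℝ} (h0 : 0 ≤ r) (h1 : r < 1) :
    Summable (fun n : ℕ => ((n : ℝ) + 1) ^ 2 * r ^ n) := by
  have h := fun k => summable_pow_mul_geometric_of_norm_lt_one (R := ℝ) k (r := r)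
    (by rwa [Real.norm_of_nonneg h0])
  refine ((h 2).add (((h 1).mul_left 2).add (h 0))).congr fun n => ?_
  ring

theorem hasSum_poisson {r t : ℝ} (h0 : 0 ≤ r) (h1 : r < 1) (ht : |t| ≤ 1) :
    HasSum (fun n : ℕ => ((n : ℝ) + 1) * r ^ n * (cheb n).eval t) (poisson r t) := by
  have hs := summable_add_one_sq_mul_pow h0 h1
  have hb : ∀ n : ℕ, |(cheb n).eval t| ≤ n + 1 := fun n => abs_eval_cheb_le n ht
  have sa : Summable (fun n : ℕ => ((n : ℝ) + 1) * r ^ n * (cheb n).eval t) := by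
    refine Summable.of_norm_bounded hs fun n => ?_
    rw [Real.norm_eq_abs, abs_mul, abs_of_nonneg (by positivity)]
    calc _ ≤ ((n : ℝ) + 1) * r ^ n * (n + 1) := by gcongr; exact hb n
      _ = _ := by ring
  have sb : Summable (fun n : ℕ => r ^ n * (cheb n).eval t) := by
    refine Summable.of_norm_bounded hs fun n => ?_
    rw [Real.norm_eq_abs, abs_mul, abs_of_nonneg (by positivity)]
    calc _ ≤ r ^ n * (n + 1) := by gcongr; exact hb n
      _ ≤ r ^ n * ((n + 1) * (n + 1)) := by
        gcongr
        nlinarith [(Nat.cast_nonneg n : (0 : ℝ) ≤ n)]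
      _ = _ := by ring
  obtain ⟨A, hA⟩ := sa
  obtain ⟨B, hB⟩ := sb
  have hA1 := (hasSum_nat_add_iff' 1).2 hA
  have hA2 := (hasSum_nat_add_iff' 2).2 hA
  have hB1 := (hasSum_nat_add_iff' 1).2 hB
  have hB2 := (hasSum_nat_add_iff' 2).2 hB
  -- The three-term recurrence, summed against rⁿ, yields with Q = 1 - 2rt + r² the equations BQ = 1
  -- and AQ = (1 - r²)B for B = Σ rⁿU_n and A = Σ (n+1)rⁿU_n.
  have eB := hB2.unique (((hB1.mul_left (2 * r * t)).sub (hB.mul_left (r ^ 2))).congr_fun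
    (fun n => by rw [eval_cheb_add_two]; ring))
  have eA := hA2.unique ((((hA1.mul_left (2 * r * t)).sub (hA.mul_left (r ^ 2))).add
    (hB2.sub (hB.mul_left (r ^ 2)))).congr_fun
    (fun n => by push_cast; rw [eval_cheb_add_two]; ring))
  simp [Finset.sum_range_succ, cheb_zero, cheb_one] at eB eA
  have hQ : 0 < 1 - 2 * r * t + r ^ 2 := by nlinarith [abs_le.1 ht]
  have hBQ : B * (1 - 2 * r * t + r ^ 2) = 1 := by linear_combination eB
  have : A = poisson r t := by
    rw [poisson, eq_div_iff (by positivity)]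
    linear_combination (1 - 2 * r * t + r ^ 2) * eA + (1 - r ^ 2) * hBQ
  exact this ▸ hA

/-- The pairing of a function with the `n`-th zonal harmonic centred at `ξ`. -/
noncomputable def coef (u : S3 → ℝ) (ξ : S3) (n : ℕ) : ℝ := ∫ x, u x * zonal ξ (cheb n) x ∂surf

/-- The Poisson integral of `u`. -/
noncomputable def poissonIntegral (r : ℝ) (u : S3 → ℝ) (ξ : S3) : ℝ :=
  (2 * Real.pi ^ 2)⁻¹ * ∫ x : S3, u x * poisson r (inner ℝ (ξ : Ambient) (x : Ambient)) ∂surf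

theorem continuous_poisson {r : ℝ} (h0 : 0 ≤ r) (h1 : r < 1) :
    Continuous (fun p : S3 × S3 => poisson r (inner ℝ (p.1 : Ambient) (p.2 : Ambient))) := by
  unfold poisson
  refine Continuous.div (by fun_prop) (by fun_prop) fun p => ?_
  have hQ : 0 < 1 - 2 * r * inner ℝ (p.1 : Ambient) (p.2 : Ambient) + r ^ 2 := by
    nlinarith [abs_le.1 (abs_inner_le_one p.1 p.2)]
  positivity

theorem continuous_poisson_right {r : ℝ} (h0 : 0 ≤ r) (h1 : r < 1) (ξ : S3) :
    Continuous (fun x : S3 => poisson r (inner ℝ (ξ : Ambient) (x : Ambient))) := by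
  unfold poisson
  refine Continuous.div (by fun_prop) (by fun_prop) fun x => ?_
  have hQ : 0 < 1 - 2 * r * inner ℝ (ξ : Ambient) (x : Ambient) + r ^ 2 := by
    nlinarith [abs_le.1 (abs_inner_le_one ξ x)]
  positivity

theorem hasSum_poissonIntegral {u : S3 → ℝ} (hu : Integrable u surf) {r : ℝ} (h0 : 0 ≤ r)
    (h1 : r < 1) (ξ : S3) :
    HasSum (fun n : ℕ => (2 * Real.pi ^ 2)⁻¹ * ((n + 1) * coef u ξ n) * r ^ n)
      (poissonIntegral r u ξ) := by
  have key := hasSum_integral_of_summable_integral_norm (μ := surf)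
    (F := fun (n : ℕ) x => u x * (((n : ℝ) + 1) * r ^ n * zonal ξ (cheb n) x))
    (fun n => integrable_mul_continuous hu (continuous_const.mul (continuous_zonal _ _))) ?_
  · have e : ∀ x : S3, ∑' n : ℕ, u x * (((n : ℝ) + 1) * r ^ n * zonal ξ (cheb n) x)
        = u x * poisson r (inner ℝ (ξ : Ambient) (x : Ambient)) := fun x =>
      ((hasSum_poisson h0 h1 (abs_inner_le_one ξ x)).mul_left (u x)).tsum_eq
    simp only [e] at key
    refine (key.mul_left (2 * Real.pi ^ 2)⁻¹).congr_fun fun n => ?_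
    rw [show (fun x => u x * (((n : ℝ) + 1) * r ^ n * zonal ξ (cheb n) x))
      = fun x => (((n : ℝ) + 1) * r ^ n) * (u x * zonal ξ (cheb n) x) by ext; ring,
      integral_const_mul, coef]
    ring
  · refine Summable.of_nonneg_of_le (fun n => integral_nonneg fun x => norm_nonneg _) (fun n => ?_)
      ((summable_add_one_sq_mul_pow h0 h1).mul_right (∫ x, ‖u x‖ ∂surf))
    rw [← integral_const_mul]
    refine integral_mono (integrable_mul_continuous hu
      (continuous_const.mul (continuous_zonal _ _))).norm (hu.norm.const_mul _) fun x => ?_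
    simp only [norm_mul, Real.norm_eq_abs]
    rw [abs_of_nonneg (by positivity : (0 : ℝ) ≤ n + 1), abs_of_nonneg (by positivity : 0 ≤ r ^ n)]
    calc _ ≤ |u x| * (((n : ℝ) + 1) * r ^ n * (n + 1)) := by
          gcongr; exact abs_zonal_cheb_le ξ n x
      _ = _ := by ring

theorem poissonIntegral_cheb (r : ℝ) (h0 : 0 ≤ r) (h1 : r < 1) (ξ : S3) (m : ℕ) :
    poissonIntegral r (zonal ξ (cheb m)) ξ = (m + 1) * r ^ m := by
  refine (hasSum_poissonIntegral (integrable_of_continuous (continuous_zonal _ _)) h0 h1 ξ).unique ?_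
  have h : ∀ n, n ≠ m → (2 * Real.pi ^ 2)⁻¹ * ((n + 1) * coef (zonal ξ (cheb m)) ξ n) * r ^ n = 0 :=
    fun n hn => by rw [coef, integral_zonal_cheb_of_ne ξ hn.symm]; ring
  convert hasSum_single m h using 1
  rw [coef, integral_zonal_cheb_sq]
  have := Real.pi_pos
  field_simp

/-- A pointwise bound for `ψ - ψ(ξ)` passes to the Poisson integral. -/
theorem abs_poissonIntegral_sub_le {ψ : S3 → ℝ} (hψ : Continuous ψ) (ξ : S3) {c ε K : ℝ}
    (hb : ∀ x : S3, |ψ x - c| ≤ ε + K * (1 - inner ℝ (ξ : Ambient) (x : Ambient))) {r : ℝ}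
    (h0 : 0 ≤ r) (h1 : r < 1) : |poissonIntegral r ψ ξ - c| ≤ ε + K * (1 - r) := by
  have hπ := Real.pi_pos
  have e0 := poissonIntegral_cheb r h0 h1 ξ 0
  have e1 := poissonIntegral_cheb r h0 h1 ξ 1
  -- As in Korovkin's theorem, two moments of the positive kernel suffice: the means of 1 and of
  -- ⟨ξ,x⟩ are 1 and r.
  simp only [poissonIntegral, zonal, cheb_zero, cheb_one, eval_mul, eval_X, eval_one,
    eval_ofNat] at e0 e1
  set P : S3 → ℝ := fun x => poisson r (inner ℝ (ξ : Ambient) (x : Ambient)) with hP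
  have hP0 : ∀ x, 0 ≤ P x := fun x => poisson_nonneg h0 h1 _
  have hPc : Continuous P := continuous_poisson_right h0 h1 ξ
  have i0 : ∫ x, P x ∂surf = 2 * Real.pi ^ 2 := by
    simp only [one_mul] at e0
    field_simp at e0
    simpa using e0
  have i1 : ∫ x : S3, inner ℝ (ξ : Ambient) (x : Ambient) * P x ∂surf = 2 * Real.pi ^ 2 * r := by
    rw [show (fun x : S3 => 2 * inner ℝ (ξ : Ambient) (x : Ambient)
        * poisson r (inner ℝ (ξ : Ambient) (x : Ambient)))
      = fun x : S3 => 2 * (inner ℝ (ξ : Ambient) (x : Ambient) * P x) by ext; simp only [hP]; ring,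
      integral_const_mul] at e1
    field_simp at e1
    push_cast at e1
    linarith
  have hI : ∫ x, (ψ x - c) * P x ∂surf = ∫ x, ψ x * P x ∂surf - c * (2 * Real.pi ^ 2) := by
    rw [← i0, ← integral_const_mul, ← integral_sub (integrable_of_continuous (by fun_prop))
      (integrable_of_continuous (by fun_prop))]
    congr 1; ext; ring
  have e : poissonIntegral r ψ ξ - c
      = (2 * Real.pi ^ 2)⁻¹ * ∫ x, (ψ x - c) * P x ∂surf := by
    rw [hI, poissonIntegral]
    simp only [hP]
    field_simp
  have hJ : ∫ x : S3, (ε + K * (1 - inner ℝ (ξ : Ambient) (x : Ambient))) * P x ∂surf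
      = (ε + K * (1 - r)) * (2 * Real.pi ^ 2) := by
    rw [show (fun x : S3 => (ε + K * (1 - inner ℝ (ξ : Ambient) (x : Ambient))) * P x)
      = fun x : S3 => (ε + K) * P x - K * (inner ℝ (ξ : Ambient) (x : Ambient) * P x) by
        ext; ring, integral_sub (integrable_of_continuous (by fun_prop))
        (integrable_of_continuous (by fun_prop)), integral_const_mul, integral_const_mul, i0, i1]
    ring
  have hle : |∫ x, (ψ x - c) * P x ∂surf| ≤ (ε + K * (1 - r)) * (2 * Real.pi ^ 2) := by
    rw [← hJ]
    refine (abs_integral_le_integral_abs).trans (integral_mono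
      (integrable_of_continuous (by fun_prop)) (integrable_of_continuous (by fun_prop)) fun x => ?_)
    simp only [abs_mul, abs_of_nonneg (hP0 x)]
    exact mul_le_mul_of_nonneg_right (hb x) (hP0 x)
  rw [e, abs_mul, abs_of_pos (by positivity), inv_mul_le_iff₀ (by positivity)]
  linarith

theorem norm_sub_sq_eq (ξ x : S3) :
    ‖(x : Ambient) - ξ‖ ^ 2 = 2 * (1 - inner ℝ (ξ : Ambient) (x : Ambient)) := by
  rw [norm_sub_sq_real, norm_eq_of_mem_sphere, norm_eq_of_mem_sphere, real_inner_comm]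
  ring

theorem tendsto_poissonIntegral {ψ : S3 → ℝ} (hψ : Continuous ψ) (ξ : S3) :
    Tendsto (fun r => poissonIntegral r ψ ξ) (nhdsWithin 1 (Set.Iio 1)) (nhds (ψ ξ)) := by
  obtain ⟨M, hM⟩ := isCompact_univ.exists_bound_of_continuousOn hψ.continuousOn
  have hM0 : 0 ≤ M := (norm_nonneg _).trans (hM ξ trivial)
  rw [Metric.tendsto_nhds]
  intro ε hε
  obtain ⟨δ, hδ, hd⟩ := Metric.continuous_iff.1 hψ ξ (ε / 2) (by positivity)
  -- Outside the δ-ball 1 - ⟨ξ,x⟩ is at least δ²/2, so K(1 - ⟨ξ,x⟩) exceeds the trivial bound 2M.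
  set K : ℝ := 2 * M / (δ ^ 2 / 2) with hK
  have hK0 : 0 ≤ K := by positivity
  have hb : ∀ x : S3, |ψ x - ψ ξ| ≤ ε / 2 + K * (1 - inner ℝ (ξ : Ambient) (x : Ambient)) := by
    intro x
    have ht := (abs_le.1 (abs_inner_le_one ξ x)).2
    rcases lt_or_ge (dist x ξ) δ with h | h
    · have := (hd x h).le
      rw [Real.dist_eq] at this
      nlinarith
    · have h1 : δ ^ 2 ≤ 2 * (1 - inner ℝ (ξ : Ambient) (x : Ambient)) := by
        rw [← norm_sub_sq_eq, ← dist_eq_norm]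
        exact pow_le_pow_left₀ hδ.le h 2
      have h2 : 2 * M ≤ K * (1 - inner ℝ (ξ : Ambient) (x : Ambient)) := by
        rw [hK, div_mul_eq_mul_div, le_div_iff₀ (by positivity)]
        nlinarith
      have h3 : |ψ x - ψ ξ| ≤ 2 * M := by
        have a := hM x trivial
        have b := hM ξ trivial
        rw [Real.norm_eq_abs] at a b
        calc _ ≤ |ψ x| + |ψ ξ| := abs_sub _ _
          _ ≤ _ := by linarith
      linarith
  have hlim : Tendsto (fun r : ℝ => ε / 2 + K * (1 - r)) (nhdsWithin 1 (Set.Iio 1))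
      (nhds (ε / 2)) := by
    have : Tendsto (fun r : ℝ => ε / 2 + K * (1 - r)) (nhds 1) (nhds (ε / 2 + K * (1 - 1))) :=
      Continuous.tendsto (by fun_prop) 1
    simpa using this.mono_left nhdsWithin_le_nhds
  filter_upwards [hlim.eventually (gt_mem_nhds (half_lt_self hε)), self_mem_nhdsWithin,
    mem_nhdsWithin_of_mem_nhds (Ioi_mem_nhds (zero_lt_one' ℝ))] with r hr h1 h0
  rw [Real.dist_eq]
  exact (abs_poissonIntegral_sub_le hψ ξ hb (le_of_lt h0) h1).trans_lt hr

theorem abs_poissonIntegral_le {ψ : S3 → ℝ} (hψ : Continuous ψ) {M : ℝ} (hM : ∀ x, |ψ x| ≤ M)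
    {r : ℝ} (h0 : 0 ≤ r) (h1 : r < 1) (ξ : S3) : |poissonIntegral r ψ ξ| ≤ M := by
  simpa using abs_poissonIntegral_sub_le hψ ξ (c := 0) (ε := M) (K := 0) (by simpa using hM) h0 h1

/-! ### Duality estimates -/

/-- A zonal polynomial with coefficients `b` in the Chebyshev basis. -/
noncomputable def zonalPoly (S : Finset ℕ) (b : ℕ → ℝ) : ℝ[X] := ∑ n ∈ S, C (b n) * cheb n

theorem zonalLaplacian_zonalPoly (S : Finset ℕ) (b : ℕ → ℝ) :
    zonalLaplacian (zonalPoly S b) = zonalPoly S (fun n => -eigen n * b n) := by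
  have h : ∀ n, (1 - X ^ 2) * derivative (derivative (C (b n) * cheb n))
      - 3 * X * derivative (C (b n) * cheb n) = C (-eigen n * b n) * cheb n := fun n => by
    have := zonalLaplacian_cheb n
    rw [zonalLaplacian] at this
    rw [derivative_C_mul, derivative_C_mul, C_mul]
    linear_combination C (b n) * this
  simp only [zonalLaplacian, zonalPoly, derivative_sum, Finset.mul_sum, ← Finset.sum_sub_distrib, h]

theorem zonal_zonalPoly (ξ : S3) (S : Finset ℕ) (b : ℕ → ℝ) (x : S3) :
    zonal ξ (zonalPoly S b) x = ∑ n ∈ S, b n * zonal ξ (cheb n) x := by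
  simp only [zonalPoly, zonal_sum, zonal_C_mul]

theorem integral_mul_zonalPoly {u : S3 → ℝ} (hu : Integrable u surf) (ξ : S3) (S : Finset ℕ)
    (b : ℕ → ℝ) : ∫ x, u x * zonal ξ (zonalPoly S b) x ∂surf = ∑ n ∈ S, b n * coef u ξ n := by
  simp only [zonal_zonalPoly, Finset.mul_sum]
  rw [integral_finsetSum]
  · refine Finset.sum_congr rfl fun n _ => ?_
    rw [coef, ← integral_const_mul]
    congr 1; ext; ring
  · intro n _
    exact integrable_mul_continuous hu (continuous_const.mul (continuous_zonal _ _))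

theorem coef_zonalPoly (ξ : S3) (S : Finset ℕ) (b : ℕ → ℝ) {n : ℕ} (hn : n ∈ S) :
    coef (zonal ξ (zonalPoly S b)) ξ n = 2 * Real.pi ^ 2 * b n := by
  rw [coef, show (fun x => zonal ξ (zonalPoly S b) x * zonal ξ (cheb n) x)
    = fun x => zonal ξ (cheb n) x * zonal ξ (zonalPoly S b) x by ext; ring,
    integral_mul_zonalPoly (integrable_of_continuous (continuous_zonal _ _)),
    Finset.sum_eq_single n]
  · rw [coef, integral_zonal_cheb_sq]; ring
  · intro m _ hm
    rw [coef, integral_zonal_cheb_of_ne ξ hm.symm, mul_zero]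
  · exact fun h => absurd hn h

theorem integral_zonalPoly_mul_zonalPoly (ξ : S3) (S : Finset ℕ) (b c : ℕ → ℝ) :
    ∫ x, zonal ξ (zonalPoly S b) x * zonal ξ (zonalPoly S c) x ∂surf
      = 2 * Real.pi ^ 2 * ∑ n ∈ S, b n * c n := by
  rw [integral_mul_zonalPoly (integrable_of_continuous (continuous_zonal _ _)), Finset.mul_sum]
  refine Finset.sum_congr rfl fun n hn => ?_
  rw [coef_zonalPoly ξ S b hn]
  ring

section H2

variable {u : S3 → ℝ} {g : S3 → Ambient} {h : Fin 4 → S3 → Ambient}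

/-- The Cauchy-Schwarz inequality for the form `∫ Δu Δv + s ∫ ∇u·∇v`, where `v` is zonal. -/
theorem IsH2.sq_sum_coef_le_aux (H : IsH2 u g h) (ξ : S3) (S : Finset ℕ) (b : ℕ → ℝ) {s : ℝ}
    (hs : 0 ≤ s) :
    (∑ n ∈ S, b n * (eigen n * (eigen n + s)) * coef u ξ n) ^ 2
      ≤ (∫ x, laplacian h x ^ 2 ∂surf + s * ∫ x, ‖g x‖ ^ 2 ∂surf)
        * (2 * Real.pi ^ 2 * ∑ n ∈ S, b n ^ 2 * (eigen n * (eigen n + s))) := by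
  set f := zonalPoly S b with hf
  set B : S3 → ℝ := zonal ξ (zonalLaplacian f) with hB
  set q : Fin 4 → S3 → ℝ := fun i x => zonalField ξ f i x with hq
  set A : S3 → ℝ := laplacian h with hA
  have cB : Continuous B := continuous_zonal _ _
  have cq : ∀ i, Continuous (q i) := fun i =>
    (contDiff_zonalField ξ f i).continuous.comp continuous_subtype_val
  have iA : Integrable A surf := H.memLp_laplacian.integrable (by norm_num)
  have iAA : Integrable (fun x => A x ^ 2) surf := H.memLp_laplacian.integrable_sq
  have ipp : Integrable (fun x => ∑ i, g x i ^ 2) surf :=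
    integrable_finsetSum _ fun i _ => (memLp_coord H.memLp_grad i).integrable_sq
  have iAB : Integrable (fun x => A x * B x) surf := integrable_mul_continuous iA cB
  have ipq : Integrable (fun x => ∑ i, g x i * q i x) surf :=
    integrable_finsetSum _ fun i _ => integrable_mul_continuous (H.integrable_grad i) (cq i)
  have iBB : Integrable (fun x => B x ^ 2) surf := integrable_of_continuous (by fun_prop)
  have iqq : Integrable (fun x => ∑ i, q i x * q i x) surf := integrable_of_continuous (by fun_prop)
  have eg : ∫ x, ‖g x‖ ^ 2 ∂surf = ∫ x, ∑ i, g x i ^ 2 ∂surf := by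
    congr 1; ext x; rw [EuclideanSpace.norm_sq_eq]; simp
  have eAB : ∫ x, A x * B x ∂surf = ∑ n ∈ S, b n * eigen n ^ 2 * coef u ξ n := by
    rw [hB, hA, H.integral_laplacian_mul_zonal, hf, zonalLaplacian_zonalPoly,
      zonalLaplacian_zonalPoly, integral_mul_zonalPoly H.integrable]
    refine Finset.sum_congr rfl fun n _ => by ring
  have epq : ∫ x, ∑ i, g x i * q i x ∂surf = ∑ n ∈ S, b n * eigen n * coef u ξ n := by
    rw [← neg_neg (∫ x, ∑ i, g x i * q i x ∂surf),
      ← H.integral_mul_zonalLaplacian_eq_grad, hf, zonalLaplacian_zonalPoly,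
      integral_mul_zonalPoly H.integrable, ← Finset.sum_neg_distrib]
    refine Finset.sum_congr rfl fun n _ => by ring
  have eBB : ∫ x, B x ^ 2 ∂surf = 2 * Real.pi ^ 2 * ∑ n ∈ S, b n ^ 2 * eigen n ^ 2 := by
    simp only [sq (B _)]
    rw [hB, hf, zonalLaplacian_zonalPoly, integral_zonalPoly_mul_zonalPoly]
    congr 1
    refine Finset.sum_congr rfl fun n _ => by ring
  have eqq : ∫ x, ∑ i, q i x * q i x ∂surf = 2 * Real.pi ^ 2 * ∑ n ∈ S, b n ^ 2 * eigen n := by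
    have := (isH2_zonal ξ f).integral_mul_zonalLaplacian_eq_grad ξ f
    simp only [tangentGrad_zonalExt] at this
    rw [← neg_neg (∫ x, ∑ i, q i x * q i x ∂surf), ← this, hf, zonalLaplacian_zonalPoly,
      integral_zonalPoly_mul_zonalPoly, ← mul_neg, ← Finset.sum_neg_distrib]
    congr 1
    refine Finset.sum_congr rfl fun n _ => by ring
  -- The form evaluated at u - cv is a nonnegative quadratic in c; its discriminant gives the
  -- inequality.
  have hquad : ∀ c : ℝ, 0 ≤ (∫ x, B x ^ 2 ∂surf + s * ∫ x, ∑ i, q i x * q i x ∂surf) * (c * c)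
      + (-2 * (∫ x, A x * B x ∂surf + s * ∫ x, ∑ i, g x i * q i x ∂surf)) * c
      + (∫ x, A x ^ 2 ∂surf + s * ∫ x, ∑ i, g x i ^ 2 ∂surf) := fun c => by
    have hn : 0 ≤ ∫ x, ((A x - c * B x) ^ 2 + s * ∑ i, (g x i - c * q i x) ^ 2) ∂surf :=
      integral_nonneg fun x => by positivity
    have e : ∀ x, (A x - c * B x) ^ 2 + s * ∑ i, (g x i - c * q i x) ^ 2
        = ((c * c) * B x ^ 2 + (c * c * s) * ∑ i, q i x * q i x)
          + ((-2 * c) * (A x * B x) + (-2 * c * s) * ∑ i, g x i * q i x)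
          + (A x ^ 2 + s * ∑ i, g x i ^ 2) := fun x => by
      simp only [Fin.sum_univ_four]
      ring
    simp only [e] at hn
    have j1 : Integrable (fun x => (c * c) * B x ^ 2 + (c * c * s) * ∑ i, q i x * q i x) surf :=
      (iBB.const_mul _).add (iqq.const_mul _)
    have j2 : Integrable
        (fun x => (-2 * c) * (A x * B x) + (-2 * c * s) * ∑ i, g x i * q i x) surf :=
      (iAB.const_mul _).add (ipq.const_mul _)
    have j12 : Integrable (fun x => ((c * c) * B x ^ 2 + (c * c * s) * ∑ i, q i x * q i x)
        + ((-2 * c) * (A x * B x) + (-2 * c * s) * ∑ i, g x i * q i x)) surf := j1.add j2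
    have j3 : Integrable (fun x => A x ^ 2 + s * ∑ i, g x i ^ 2) surf := iAA.add (ipp.const_mul _)
    rw [integral_add j12 j3, integral_add j1 j2,
      integral_add (iBB.const_mul _) (iqq.const_mul _),
      integral_add (iAB.const_mul _) (ipq.const_mul _),
      integral_add iAA (ipp.const_mul _)] at hn
    simp only [integral_const_mul] at hn
    linarith
  have hd := discrim_le_zero hquad
  rw [eAB, epq, eBB, eqq] at hd
  rw [eg]
  have e1 : ∑ n ∈ S, b n * (eigen n * (eigen n + s)) * coef u ξ n
      = ∑ n ∈ S, b n * eigen n ^ 2 * coef u ξ n + s * ∑ n ∈ S, b n * eigen n * coef u ξ n := by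
    rw [Finset.mul_sum, ← Finset.sum_add_distrib]
    refine Finset.sum_congr rfl fun n _ => by ring
  have e2 : ∑ n ∈ S, b n ^ 2 * (eigen n * (eigen n + s))
      = ∑ n ∈ S, b n ^ 2 * eigen n ^ 2 + s * ∑ n ∈ S, b n ^ 2 * eigen n := by
    rw [Finset.mul_sum, ← Finset.sum_add_distrib]
    refine Finset.sum_congr rfl fun n _ => by ring
  rw [e1, e2]
  unfold discrim at hd
  nlinarith

/-- The form is diagonal with entries λ_n(λ_n+s), so dividing the coefficients by them represents an
arbitrary functional of the harmonic coefficients. The zero mode is excluded because λ_0 = 0. -/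
theorem IsH2.sq_sum_coef_le (H : IsH2 u g h) (ξ : S3) (S : Finset ℕ) (hS : 0 ∉ S) (a : ℕ → ℝ)
    {s : ℝ} (hs : 0 ≤ s) :
    (∑ n ∈ S, a n * coef u ξ n) ^ 2
      ≤ (∫ x, laplacian h x ^ 2 ∂surf + s * ∫ x, ‖g x‖ ^ 2 ∂surf)
        * (2 * Real.pi ^ 2 * ∑ n ∈ S, a n ^ 2 / (eigen n * (eigen n + s))) := by
  have key := H.sq_sum_coef_le_aux ξ S (fun n => a n / (eigen n * (eigen n + s))) hs
  have hne : ∀ n ∈ S, eigen n * (eigen n + s) ≠ 0 := fun n hn => by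
    have := three_le_eigen (n := n) (fun h0 => hS (h0 ▸ hn))
    positivity
  have e1 : ∑ n ∈ S, a n / (eigen n * (eigen n + s)) * (eigen n * (eigen n + s)) * coef u ξ n
      = ∑ n ∈ S, a n * coef u ξ n :=
    Finset.sum_congr rfl fun n hn => by rw [div_mul_cancel₀ _ (hne n hn)]
  have e2 : ∑ n ∈ S, (a n / (eigen n * (eigen n + s))) ^ 2 * (eigen n * (eigen n + s))
      = ∑ n ∈ S, a n ^ 2 / (eigen n * (eigen n + s)) :=
    Finset.sum_congr rfl fun n hn => by
      have := hne n hn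
      field_simp
  rwa [e1, e2] at key

end H2

/-! ### The zonal expansion and the continuous representative -/

/-- The weights in the extremal problem. -/
noncomputable def weight (s : ℝ) (n : ℕ) : ℝ := ((n : ℝ) + 1) ^ 2 / (eigen n * (eigen n + s))

theorem weight_nonneg {s : ℝ} (hs : 0 ≤ s) (n : ℕ) : 0 ≤ weight s n := by
  have := eigen_nonneg n
  unfold weight; positivity

theorem weight_zero (s : ℝ) : weight s 0 = 0 := by simp [weight, eigen_zero]

theorem weight_anti {s t : ℝ} (hs : 0 ≤ s) (hst : s ≤ t) (n : ℕ) : weight t n ≤ weight s n := by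
  rcases eq_or_ne n 0 with rfl | hn
  · simp [weight_zero]
  · have := three_le_eigen hn
    unfold weight
    gcongr

theorem weight_le {s : ℝ} (hs : 0 ≤ s) (n : ℕ) : weight s n ≤ 1 / (n : ℝ) ^ 2 := by
  refine (weight_anti le_rfl hs n).trans ?_
  rcases eq_or_ne n 0 with rfl | hn
  · simp [weight_zero]
  · have : (0 : ℝ) < n := by exact_mod_cast Nat.pos_of_ne_zero hn
    unfold weight eigen
    rw [add_zero, div_le_div_iff₀ (by positivity) (by positivity)]
    have : (n : ℝ) + 1 ≤ n + 2 := by linarith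
    calc _ ≤ ((n : ℝ) + 2) ^ 2 * n ^ 2 := by gcongr
      _ = _ := by ring

theorem summable_weight {s : ℝ} (hs : 0 ≤ s) : Summable (weight s) :=
  Summable.of_nonneg_of_le (weight_nonneg hs) (weight_le hs)
    (Real.summable_one_div_nat_pow.2 (by norm_num))

/-- The partial sums of the expansion of `u(ξ)` in spherical harmonics. -/
noncomputable def partialSum (u : S3 → ℝ) (N : ℕ) (ξ : S3) : ℝ :=
  ∑ n ∈ Finset.range N, (2 * Real.pi ^ 2)⁻¹ * ((n + 1) * coef u ξ n)

theorem continuous_coef {u : S3 → ℝ} (hu : Integrable u surf) (n : ℕ) :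
    Continuous (fun ξ => coef u ξ n) := by
  unfold coef
  refine continuous_of_dominated (bound := fun x => ‖u x‖ * (n + 1)) (fun ξ =>
    (integrable_mul_continuous hu (continuous_zonal _ _)).aestronglyMeasurable)
    (fun ξ => Eventually.of_forall fun x => ?_) (hu.norm.mul_const _)
    (Eventually.of_forall fun x => ?_)
  · rw [norm_mul]
    gcongr
    exact abs_zonal_cheb_le ξ n x
  · unfold zonal
    have := (cheb n).continuous
    fun_prop

theorem continuous_partialSum {u : S3 → ℝ} (hu : Integrable u surf) (N : ℕ) :
    Continuous (partialSum u N) := by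
  have := fun n => continuous_coef hu n
  unfold partialSum
  fun_prop

section H2

variable {u : S3 → ℝ} {g : S3 → Ambient} {h : Fin 4 → S3 → Ambient}

/-- The free factors a_n serve two purposes: a_n = 1 gives partial sums of the expansion, and a_n =
rⁿ gives Poisson sums with a bound uniform in r. -/
theorem IsH2.sq_weighted_sum_le (H : IsH2 u g h) (ξ : S3) (S : Finset ℕ) (hS : 0 ∉ S)
    {a : ℕ → ℝ} (ha : ∀ n, |a n| ≤ 1) {s : ℝ} (hs : 0 ≤ s) :
    (∑ n ∈ S, (2 * Real.pi ^ 2)⁻¹ * ((n + 1) * coef u ξ n) * a n) ^ 2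
      ≤ (∫ x, laplacian h x ^ 2 ∂surf + s * ∫ x, ‖g x‖ ^ 2 ∂surf)
        * ((2 * Real.pi ^ 2)⁻¹ * ∑ n ∈ S, weight s n) := by
  have key := H.sq_sum_coef_le ξ S hS (fun n => (2 * Real.pi ^ 2)⁻¹ * (n + 1) * a n) hs
  have hE : 0 ≤ ∫ x, laplacian h x ^ 2 ∂surf + s * ∫ x, ‖g x‖ ^ 2 ∂surf :=
    add_nonneg (integral_nonneg fun _ => sq_nonneg _)
      (mul_nonneg hs (integral_nonneg fun _ => sq_nonneg _))
  rw [Finset.sum_congr rfl fun n _ => show (2 * Real.pi ^ 2)⁻¹ * ((n + 1) * coef u ξ n) * a n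
    = (2 * Real.pi ^ 2)⁻¹ * (n + 1) * a n * coef u ξ n by ring]
  refine key.trans (mul_le_mul_of_nonneg_left ?_ hE)
  have hπ := Real.pi_pos
  rw [Finset.mul_sum, Finset.mul_sum]
  refine Finset.sum_le_sum fun n _ => ?_
  have h1 : a n ^ 2 ≤ 1 := by rw [sq_le_one_iff_abs_le_one]; exact ha n
  have e : 2 * Real.pi ^ 2 * (((2 * Real.pi ^ 2)⁻¹ * (n + 1) * a n) ^ 2 /
      (eigen n * (eigen n + s))) = (2 * Real.pi ^ 2)⁻¹ * weight s n * a n ^ 2 := by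
    unfold weight
    field_simp
  rw [e]
  have hw := weight_nonneg hs n
  exact mul_le_of_le_one_right (by positivity) h1

theorem sum_Ico_weight_le {s : ℝ} (hs : 0 ≤ s) (N M : ℕ) :
    ∑ n ∈ Finset.Ico N M, weight s n ≤ ∑' k, weight s (k + N) := by
  rw [Finset.sum_Ico_eq_sum_range]
  simp only [add_comm N]
  exact ((summable_nat_add_iff N).2 (summable_weight hs)).sum_le_tsum _
    fun n _ => weight_nonneg hs _

theorem IsH2.sq_sub_partialSum_le (H : IsH2 u g h) (ξ : S3) {N M : ℕ} (hN : 1 ≤ N) (hNM : N ≤ M) :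
    (partialSum u N ξ - partialSum u M ξ) ^ 2
      ≤ (∫ x, laplacian h x ^ 2 ∂surf) * ((2 * Real.pi ^ 2)⁻¹ * ∑' k, weight 0 (k + N)) := by
  have key := H.sq_weighted_sum_le ξ (Finset.Ico N M) (by simp; omega) (a := fun _ => 1)
    (by simp) le_rfl
  simp only [mul_one, zero_mul, add_zero] at key
  rw [← neg_sq, neg_sub, partialSum, partialSum, ← Finset.sum_Ico_eq_sub _ hNM]
  have hE : 0 ≤ ∫ x, laplacian h x ^ 2 ∂surf := integral_nonneg fun _ => sq_nonneg _
  have hπ := Real.pi_pos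
  have := sum_Ico_weight_le le_rfl N M
  exact key.trans (by gcongr)

/-- The tails are bounded, uniformly in ξ, by tails of the convergent series of weights at s = 0, so
the partial sums are Cauchy in C(𝕊³). -/
theorem IsH2.exists_limit_partialSum (H : IsH2 u g h) :
    ∃ w : S3 → ℝ, Continuous w ∧ ∀ ξ, Tendsto (fun N => partialSum u N ξ) atTop (nhds (w ξ)) := by
  set F : ℕ → C(S3, ℝ) := fun N => ⟨partialSum u (N + 1), continuous_partialSum H.integrable _⟩
    with hF
  set E := ∫ x, laplacian h x ^ 2 ∂surf with hE
  have hE0 : 0 ≤ E := integral_nonneg fun _ => sq_nonneg _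
  have hπ := Real.pi_pos
  have hC : CauchySeq F := by
    refine cauchySeq_of_le_tendsto_0'
      (fun N => Real.sqrt (E * ((2 * Real.pi ^ 2)⁻¹ * ∑' k, weight 0 (k + (N + 1))))) ?_ ?_
    · intro N M hNM
      rw [ContinuousMap.dist_le (Real.sqrt_nonneg _)]
      intro ξ
      rw [Real.dist_eq]
      refine Real.abs_le_sqrt ?_
      exact H.sq_sub_partialSum_le ξ (by omega) (by omega)
    · have h1 := (tendsto_sum_nat_add (weight 0)).comp (tendsto_add_atTop_nat 1)
      have h2 := ((h1.const_mul (2 * Real.pi ^ 2)⁻¹).const_mul E).sqrt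
      simpa using h2
  obtain ⟨w, hw⟩ := cauchySeq_tendsto_of_complete hC
  refine ⟨w, w.continuous, fun ξ => ?_⟩
  rw [← tendsto_add_atTop_iff_nat 1]
  exact ((continuous_eval_const ξ).tendsto w).comp hw

/-- The bound supplies the majorant for dominated convergence as r → 1. -/
theorem IsH2.exists_bound_poissonIntegral (H : IsH2 u g h) :
    ∃ K : ℝ, ∀ r, 0 ≤ r → r < 1 → ∀ ξ, |poissonIntegral r u ξ| ≤ K := by
  set E := ∫ x, laplacian h x ^ 2 ∂surf with hE
  have hE0 : 0 ≤ E := integral_nonneg fun _ => sq_nonneg _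
  have hπ := Real.pi_pos
  refine ⟨|(2 * Real.pi ^ 2)⁻¹ * ∫ x, u x ∂surf|
    + Real.sqrt (E * ((2 * Real.pi ^ 2)⁻¹ * ∑' k, weight 0 (k + 1))), fun r h0 h1 ξ => ?_⟩
  have hs := ((hasSum_poissonIntegral H.integrable h0 h1 ξ).tendsto_sum_nat.comp
    (tendsto_add_atTop_nat 1)).abs
  refine le_of_tendsto hs (Eventually.of_forall fun N => ?_)
  simp only [Function.comp_apply]
  rw [Finset.range_eq_Ico, Finset.sum_eq_sum_Ico_succ_bot (by omega)]
  refine (abs_add_le _ _).trans (add_le_add (le_of_eq ?_) ?_)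
  · simp [coef, zonal, cheb_zero]
  · refine Real.abs_le_sqrt ?_
    have key := H.sq_weighted_sum_le ξ (Finset.Ico 1 (N + 1)) (by simp) (a := fun n => r ^ n)
      (fun n => by rw [abs_of_nonneg (by positivity)]; exact pow_le_one₀ h0 h1.le) le_rfl
    simp only [zero_mul, add_zero] at key
    have := sum_Ico_weight_le le_rfl 1 (N + 1)
    exact key.trans (by gcongr)

/-! ### Identification of the limit of the expansion with u -/

theorem integrable_poisson_prod {u ψ : S3 → ℝ} (hu : Integrable u surf) (hψ : Continuous ψ) {r : ℝ}
    (h0 : 0 ≤ r) (h1 : r < 1) : Integrable (fun p : S3 × S3 =>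
      ψ p.1 * u p.2 * poisson r (inner ℝ (p.1 : Ambient) (p.2 : Ambient))) (surf.prod surf) := by
  have hc := continuous_poisson h0 h1
  obtain ⟨K, hK⟩ := isCompact_univ.exists_bound_of_continuousOn hc.continuousOn
  exact ((integrable_of_continuous hψ).mul_prod hu).mul_bdd hc.aestronglyMeasurable
    (Eventually.of_forall fun p => hK p trivial)

/-- The Poisson integral is symmetric. -/
theorem integral_poissonIntegral_mul {u ψ : S3 → ℝ} (hu : Integrable u surf) (hψ : Continuous ψ)
    {r : ℝ} (h0 : 0 ≤ r) (h1 : r < 1) :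
    ∫ ξ, poissonIntegral r u ξ * ψ ξ ∂surf = ∫ x, u x * poissonIntegral r ψ x ∂surf := by
  have key := integral_integral_swap
    (f := fun ξ x : S3 => ψ ξ * u x * poisson r (inner ℝ (ξ : Ambient) (x : Ambient)))
    (integrable_poisson_prod hu hψ h0 h1)
  have e1 : ∀ ξ, poissonIntegral r u ξ * ψ ξ = (2 * Real.pi ^ 2)⁻¹ *
      ∫ x : S3, ψ ξ * u x * poisson r (inner ℝ (ξ : Ambient) (x : Ambient)) ∂surf := fun ξ => by
    simp only [mul_assoc (ψ ξ)]
    rw [integral_const_mul, poissonIntegral]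
    ring
  have e2 : ∀ x, u x * poissonIntegral r ψ x = (2 * Real.pi ^ 2)⁻¹ *
      ∫ ξ : S3, ψ ξ * u x * poisson r (inner ℝ (ξ : Ambient) (x : Ambient)) ∂surf := fun x => by
    simp only [mul_comm (ψ _) (u x), mul_assoc (u x), real_inner_comm (x : Ambient)]
    rw [integral_const_mul, poissonIntegral]
    ring
  simp only [e1, e2, integral_const_mul, key]

theorem aestronglyMeasurable_poissonIntegral_mul {u ψ : S3 → ℝ} (hu : Integrable u surf)
    (hψ : Continuous ψ) {r : ℝ} (h0 : 0 ≤ r) (h1 : r < 1) :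
    AEStronglyMeasurable (fun ξ => poissonIntegral r u ξ * ψ ξ) surf := by
  have := (integrable_poisson_prod hu hψ h0 h1).integral_prod_left.aestronglyMeasurable.const_mul
    (2 * Real.pi ^ 2)⁻¹
  refine this.congr (Eventually.of_forall fun ξ => ?_)
  simp only [mul_assoc (ψ ξ)]
  rw [integral_const_mul, poissonIntegral]
  ring

theorem ae_eq_of_forall_integral_mul_continuous_eq {v w : S3 → ℝ} (hv : MemLp v 2 surf)
    (hw : MemLp w 2 surf)
    (heq : ∀ ψ : S3 → ℝ, Continuous ψ → ∫ x, v x * ψ x ∂surf = ∫ x, w x * ψ x ∂surf) :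
    v =ᵐ[surf] w := by
  have hd := ContinuousMap.toLp_denseRange (p := 2) ℝ surf ℝ (by norm_num)
  have h0 : (hv.sub hw).toLp (v - w) = 0 := by
    refine hd.eq_zero_of_inner_left ℝ fun ψ => ?_
    rw [L2.inner_def]
    have e : (fun x => inner ℝ (((hv.sub hw).toLp (v - w) : Lp ℝ 2 surf) x)
        ((ContinuousMap.toLp 2 surf ℝ ψ : Lp ℝ 2 surf) x))
        =ᵐ[surf] fun x => v x * ψ x - w x * ψ x := by
      filter_upwards [(hv.sub hw).coeFn_toLp, ContinuousMap.coeFn_toLp (p := 2) (𝕜 := ℝ) surf ψ]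
        with x h1 h2
      rw [h1, h2]
      simp
      ring
    rw [integral_congr_ae e, integral_sub (integrable_mul_continuous (hv.integrable (by norm_num))
      ψ.continuous) (integrable_mul_continuous (hw.integrable (by norm_num)) ψ.continuous),
      heq ψ ψ.continuous, sub_self]
  rw [← MemLp.toLp_zero (MemLp.zero' (p := 2) (μ := surf)), MemLp.toLp_eq_toLp_iff] at h0
  filter_upwards [h0] with x hx
  simpa [sub_eq_zero] using hx

/-- A function in `H²(𝕊³)` has a continuous representative, to which the expansion in spherical
harmonics converges pointwise. -/
theorem IsH2.exists_continuous_representative (H : IsH2 u g h) :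
    ∃ w : S3 → ℝ, Continuous w ∧ w =ᵐ[surf] u ∧
      ∀ ξ, Tendsto (fun N => partialSum u N ξ) atTop (nhds (w ξ)) := by
  obtain ⟨w, hwc, hw⟩ := H.exists_limit_partialSum
  refine ⟨w, hwc, ?_, hw⟩
  refine ae_eq_of_forall_integral_mul_continuous_eq (memLp_of_continuous hwc) H.memLp
    fun ψ hψ => ?_
  have hev : ∀ᶠ r : ℝ in nhdsWithin 1 (Set.Iio 1), 0 ≤ r ∧ r < 1 := by
    filter_upwards [self_mem_nhdsWithin,
      mem_nhdsWithin_of_mem_nhds (Ioi_mem_nhds (zero_lt_one' ℝ))] with r h1 h0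
    exact ⟨le_of_lt h0, h1⟩
  obtain ⟨K, hK⟩ := H.exists_bound_poissonIntegral
  obtain ⟨M, hM⟩ := isCompact_univ.exists_bound_of_continuousOn hψ.continuousOn
  have hpt : ∀ ξ, Tendsto (fun r => poissonIntegral r u ξ) (nhdsWithin 1 (Set.Iio 1))
      (nhds (w ξ)) := fun ξ => by
    -- Abel's theorem: the Poisson integrals are the Abel means of the convergent expansion. By
    -- symmetry they also converge to u when tested against continuous ψ, which forces w = u almost
    -- everywhere.
    refine (Real.tendsto_tsum_powerSeries_nhdsWithin_lt (hw ξ)).congr' ?_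
    filter_upwards [hev] with r hr
    exact (hasSum_poissonIntegral H.integrable hr.1 hr.2 ξ).tsum_eq
  have l1 : Tendsto (fun r => ∫ ξ, poissonIntegral r u ξ * ψ ξ ∂surf) (nhdsWithin 1 (Set.Iio 1))
      (nhds (∫ ξ, w ξ * ψ ξ ∂surf)) := by
    refine tendsto_integral_filter_of_dominated_convergence (fun ξ => K * ‖ψ ξ‖) ?_ ?_
      (integrable_of_continuous (by fun_prop)) (Eventually.of_forall fun ξ => (hpt ξ).mul_const _)
    · filter_upwards [hev] with r hr
      exact aestronglyMeasurable_poissonIntegral_mul H.integrable hψ hr.1 hr.2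
    · filter_upwards [hev] with r hr
      refine Eventually.of_forall fun ξ => ?_
      rw [norm_mul]
      gcongr
      exact hK r hr.1 hr.2 ξ
  have l2 : Tendsto (fun r => ∫ x, u x * poissonIntegral r ψ x ∂surf) (nhdsWithin 1 (Set.Iio 1))
      (nhds (∫ x, u x * ψ x ∂surf)) := by
    refine tendsto_integral_filter_of_dominated_convergence (fun x => ‖u x‖ * M) ?_ ?_
      (H.integrable.norm.mul_const _)
      (Eventually.of_forall fun x => (tendsto_poissonIntegral hψ x).const_mul _)
    · filter_upwards [hev] with r hr
      have := aestronglyMeasurable_poissonIntegral_mul (integrable_of_continuous hψ)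
        (continuous_const (y := (1 : ℝ))) hr.1 hr.2
      simp only [mul_one] at this
      exact H.memLp.1.mul this
    · filter_upwards [hev] with r hr
      refine Eventually.of_forall fun x => ?_
      rw [norm_mul]
      gcongr
      exact abs_poissonIntegral_le hψ (fun y => hM y trivial) hr.1 hr.2 x
  refine tendsto_nhds_unique (l1.congr' ?_) l2
  filter_upwards [hev] with r hr
  exact integral_poissonIntegral_mul H.integrable hψ hr.1 hr.2

theorem existsUnique_continuous_representative (hu : MemH2 u) :
    ∃! w : S3 → ℝ, Continuous w ∧ w =ᵐ[surf] u := by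
  obtain ⟨g, h, H⟩ := hu
  obtain ⟨w, hw, hwu, -⟩ := H.exists_continuous_representative
  refine ⟨w, ⟨hw, hwu⟩, fun v hv => ?_⟩
  exact Continuous.ae_eq_iff_eq surf hv.1 hw |>.1 (hv.2.trans hwu.symm)

/-- The pointwise bound for functions in `H²(𝕊³)` with zero mean. -/
theorem IsH2.sq_apply_le (H : IsH2 u g h) (hu : Continuous u) (h0 : ∫ x, u x ∂surf = 0) {s : ℝ}
    (hs : 0 ≤ s) (ξ : S3) :
    u ξ ^ 2 ≤ (∫ x, laplacian h x ^ 2 ∂surf + s * ∫ x, ‖g x‖ ^ 2 ∂surf)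
        * ((2 * Real.pi ^ 2)⁻¹ * ∑' n, weight s n) := by
  obtain ⟨w, hw, hwu, hlim⟩ := H.exists_continuous_representative
  obtain rfl : w = u := (Continuous.ae_eq_iff_eq surf hw hu).1 hwu
  have hE : 0 ≤ ∫ x, laplacian h x ^ 2 ∂surf + s * ∫ x, ‖g x‖ ^ 2 ∂surf :=
    add_nonneg (integral_nonneg fun _ => sq_nonneg _)
      (mul_nonneg hs (integral_nonneg fun _ => sq_nonneg _))
  have hπ := Real.pi_pos
  refine le_of_tendsto ((hlim ξ).pow 2) ?_
  filter_upwards [eventually_ge_atTop 1] with N hN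
  have hc : coef w ξ 0 = 0 := by simpa [coef, zonal, cheb_zero] using h0
  have e : partialSum w N ξ
      = ∑ n ∈ Finset.Ico 1 N, (2 * Real.pi ^ 2)⁻¹ * ((n + 1) * coef w ξ n) * 1 := by
    rw [partialSum, Finset.range_eq_Ico, Finset.sum_eq_sum_Ico_succ_bot (by omega), hc]
    simp
  rw [e]
  refine (H.sq_weighted_sum_le ξ _ (by simp) (a := fun _ => 1) (by simp) hs).trans ?_
  have := (summable_weight hs).sum_le_tsum (Finset.Ico 1 N) fun n _ => weight_nonneg hs n
  gcongr

theorem le_of_mem_extremalValues {ξ : S3} {D v s : ℝ} (hv : v ∈ extremalValues ξ D) (hs : 0 ≤ s) :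
    v ≤ (D + s) * ((2 * Real.pi ^ 2)⁻¹ * ∑' n, weight s n) := by
  obtain ⟨u, g, h, H, hu, h0, hg, hD, rfl⟩ := hv
  have := H.sq_apply_le hu h0 hs ξ
  rwa [hg, hD, mul_one, ← sq_abs] at this

end H2

/-! ### Invariance under isometries -/

theorem gradient_comp_symm (L : Ambient ≃ₗᵢ[ℝ] Ambient) {φ : Ambient → ℝ} (hφ : ContDiff ℝ ∞ φ)
    (x : Ambient) : ∇ (fun y => φ (L.symm y)) (L x) = L (∇ φ x) := by
  refine ext_inner_right ℝ fun v => ?_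
  have h1 : HasFDerivAt φ (fderiv ℝ φ x) (L.symm (L x)) := by
    rw [L.symm_apply_apply]
    exact (hφ.differentiable (by simp) x).hasFDerivAt
  have h2 : HasFDerivAt (fun y => L.symm y)
    (L.symm.toContinuousLinearEquiv : Ambient →L[ℝ] Ambient) (L x) :=
    L.symm.toContinuousLinearEquiv.hasFDerivAt
  have h3 : HasFDerivAt (fun y => φ (L.symm y)) _ (L x) := h1.comp (L x) h2
  rw [inner_gradient_left, h3.fderiv]
  have e : inner ℝ (L (∇ φ x)) v = inner ℝ (∇ φ x) (L.symm v) := by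
    rw [← L.inner_map_map (∇ φ x), L.apply_symm_apply]
  rw [e, inner_gradient_left]
  rfl

theorem tangentGrad_comp_symm (L : Ambient ≃ₗᵢ[ℝ] Ambient) {φ : Ambient → ℝ}
    (hφ : ContDiff ℝ ∞ φ) (x : S3) :
    tangentGrad (fun y => φ (L.symm y)) (sphereHomeo L x) = L (tangentGrad φ x) := by
  simp only [tangentGrad, coe_sphereHomeo, gradient_comp_symm L hφ, L.inner_map_map, map_sub,
    map_smul]

theorem HasWeakGrad.comp_sphereHomeo {u : S3 → ℝ} {g : S3 → Ambient} (hw : HasWeakGrad u g)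
    (L : Ambient ≃ₗᵢ[ℝ] Ambient) :
    HasWeakGrad (fun x => u (sphereHomeo L x)) (fun x => L.symm (g (sphereHomeo L x))) := by
  intro φ hφ
  have hφ' : ContDiff ℝ ∞ (fun y => φ (L.symm y)) := hφ.comp L.symm.contDiff
  have key := congrArg L.symm (hw _ hφ')
  have hc : ∀ F : S3 → Ambient, L.symm (∫ x, F x ∂surf)
      = ∫ x, L.symm (F (sphereHomeo L x)) ∂surf := fun F => by
    rw [integral_sphereHomeo L (fun x => L.symm (F x))]
    exact (L.symm.toContinuousLinearEquiv.integral_comp_comm F).symm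
  rw [hc, hc] at key
  simp only [map_smul, map_add, tangentGrad_comp_symm L hφ, L.symm_apply_apply,
    coe_sphereHomeo] at key
  exact key

theorem HasWeakGrad.sum {u : Fin 4 → S3 → ℝ} {g : Fin 4 → S3 → Ambient}
    (hw : ∀ j, HasWeakGrad (u j) (g j)) (hu : ∀ j, Integrable (u j) surf)
    (hg : ∀ j i, Integrable (fun x => g j x i) surf) (c : Fin 4 → ℝ) :
    HasWeakGrad (fun x => ∑ j, c j * u j x) (fun x => ∑ j, c j • g j x) := by
  intro φ hφ
  have cφ := hφ.continuous
  have gφ := continuous_tangentGrad hφ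
  have i1 : ∀ j, Integrable (fun x => u j x • tangentGrad φ x) surf := fun j =>
    Integrable.of_eval_piLp fun i =>
      integrable_mul_continuous (c := fun x => tangentGrad φ x i) (hu j) (by fun_prop)
  have i2 : ∀ j, Integrable (fun x : S3 => -(φ (x : Ambient)) • g j x
      + (3 * u j x * φ (x : Ambient)) • (x : Ambient)) surf := fun j =>
    Integrable.of_eval_piLp fun i => by
      have a := (integrable_mul_continuous (c := fun x : S3 => φ x) (hg j i) (by fun_prop)).neg
      have b := (integrable_mul_continuous (c := fun x : S3 => φ x * (x : Ambient) i) (hu j)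
        (by fun_prop)).const_mul 3
      refine (a.add b).congr (Eventually.of_forall fun x => ?_)
      simp
      ring
  have e1 : ∀ x, (∑ j, c j * u j x) • tangentGrad φ x = ∑ j, c j • (u j x • tangentGrad φ x) :=
    fun x => by simp only [Finset.sum_smul, smul_smul]
  have e2 : ∀ x : S3, (-(φ (x : Ambient)) • ∑ j, c j • g j x
      + (3 * (∑ j, c j * u j x) * φ (x : Ambient)) • (x : Ambient))
      = ∑ j, c j • (-(φ (x : Ambient)) • g j x
      + (3 * u j x * φ (x : Ambient)) • (x : Ambient)) := fun x => by
    simp only [Fin.sum_univ_four]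
    module
  simp only [e1, e2]
  have i1' : ∀ j, Integrable (fun x => c j • (u j x • tangentGrad φ x)) surf :=
    fun j => (i1 j).smul (c j)
  have i2' : ∀ j, Integrable (fun x : S3 => c j • (-(φ (x : Ambient)) • g j x
      + (3 * u j x * φ (x : Ambient)) • (x : Ambient))) surf := fun j => (i2 j).smul (c j)
  rw [integral_finsetSum _ fun j _ => i1' j, integral_finsetSum _ fun j _ => i2' j]
  refine Finset.sum_congr rfl fun j _ => ?_
  rw [integral_smul, integral_smul, hw j φ hφ]

theorem sum_coord_mul_map_single (L : Ambient →ₗ[ℝ] Ambient) (v : Ambient) (j : Fin 4) :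
    ∑ i, v i * L (EuclideanSpace.single i 1) j = L v j := by
  have hv : v = ∑ i, v i • (EuclideanSpace.single i (1 : ℝ) : Ambient) := by
    ext k
    fin_cases k <;> simp [Fin.sum_univ_four]
  conv_rhs => rw [hv]
  simp [map_sum]

theorem memLp_comp_sphereHomeo {E : Type*} [NormedAddCommGroup E] (L : Ambient ≃ₗᵢ[ℝ] Ambient)
    {f : S3 → E} (hf : MemLp f 2 surf) : MemLp (fun x => f (sphereHomeo L x)) 2 surf :=
  hf.comp_measurePreserving (measurePreserving_sphereHomeo L)

/-- The i-th coordinate of L⁻¹g is a combination of all coordinates of g, so the rows of the Hessian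
are mixed by the matrix of L: the Hessian is conjugated, and its trace is preserved. -/
theorem IsH2.comp_sphereHomeo {u : S3 → ℝ} {g : S3 → Ambient} {h : Fin 4 → S3 → Ambient}
    (H : IsH2 u g h) (L : Ambient ≃ₗᵢ[ℝ] Ambient) :
    IsH2 (fun x => u (sphereHomeo L x)) (fun x => L.symm (g (sphereHomeo L x)))
      (fun i x => ∑ j, (L (EuclideanSpace.single i 1) j) • L.symm (h j (sphereHomeo L x))) where
  memLp := memLp_comp_sphereHomeo L H.memLp
  memLp_grad := (L.symm.toContinuousLinearEquiv : Ambient →L[ℝ] Ambient).comp_memLp'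
    (memLp_comp_sphereHomeo L H.memLp_grad)
  memLp_hess i := memLp_finsetSum _ fun j _ =>
    ((L.symm.toContinuousLinearEquiv : Ambient →L[ℝ] Ambient).comp_memLp'
      (memLp_comp_sphereHomeo L (H.memLp_hess j))).const_smul (L (EuclideanSpace.single i 1) j)
  weakGrad := H.weakGrad.comp_sphereHomeo L
  weakHess i := by
    have e : ∀ x, L.symm (g (sphereHomeo L x)) i
        = ∑ j, L (EuclideanSpace.single i 1) j * g (sphereHomeo L x) j := fun x => by
      have h1 : L.symm (g (sphereHomeo L x)) i
          = inner ℝ (EuclideanSpace.single i (1 : ℝ)) (L.symm (g (sphereHomeo L x))) := by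
        rw [EuclideanSpace.inner_single_left]; simp
      rw [h1, ← L.inner_map_map, L.apply_symm_apply, inner_coord, Fin.sum_univ_four]
    simp only [e]
    refine HasWeakGrad.sum (u := fun j x => g (sphereHomeo L x) j)
      (g := fun j x => L.symm (h j (sphereHomeo L x)))
      (fun j => (H.weakHess j).comp_sphereHomeo L) (fun j => ?_) (fun j k => ?_) _
    · exact (memLp_comp_sphereHomeo L (memLp_coord H.memLp_grad j)).integrable (by norm_num)
    · exact (memLp_coord ((L.symm.toContinuousLinearEquiv : Ambient →L[ℝ] Ambient).comp_memLp'
        (memLp_comp_sphereHomeo L (H.memLp_hess j))) k).integrable (by norm_num)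

theorem laplacian_comp_sphereHomeo (h : Fin 4 → S3 → Ambient) (L : Ambient ≃ₗᵢ[ℝ] Ambient)
    (x : S3) : laplacian
      (fun i x => ∑ j, (L (EuclideanSpace.single i 1) j) • L.symm (h j (sphereHomeo L x))) x
      = laplacian h (sphereHomeo L x) := by
  simp only [laplacian, WithLp.ofLp_sum, Finset.sum_apply, PiLp.smul_apply, smul_eq_mul]
  rw [Finset.sum_comm]
  refine Finset.sum_congr rfl fun j _ => ?_
  have := sum_coord_mul_map_single L.toLinearEquiv.toLinearMap (L.symm (h j (sphereHomeo L x))) j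
  simpa [mul_comm] using this

theorem extremalValues_subset (ξ η : S3) (D : ℝ) : extremalValues ξ D ⊆ extremalValues η D := by
  rintro v ⟨u, g, h, H, hu, h0, hg, hD, rfl⟩
  set L : Ambient ≃ₗᵢ[ℝ] Ambient := (ℝ ∙ ((η : Ambient) - (ξ : Ambient)))ᗮ.reflection with hL
  have hLη : sphereHomeo L η = ξ := Subtype.ext (by
    rw [coe_sphereHomeo, hL]
    exact Submodule.reflection_sub (by simp))
  refine ⟨_, _, _, H.comp_sphereHomeo L, hu.comp (sphereHomeo L).continuous, ?_, ?_, ?_, ?_⟩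
  · rw [integral_sphereHomeo L u, h0]
  · simp only [LinearIsometryEquiv.norm_map]
    rw [integral_sphereHomeo L (fun x => ‖g x‖ ^ 2), hg]
  · simp only [laplacian_comp_sphereHomeo]
    rw [integral_sphereHomeo L (fun x => laplacian h x ^ 2), hD]
  · rw [hLη]

theorem extremalValues_eq (ξ η : S3) (D : ℝ) : extremalValues ξ D = extremalValues η D :=
  (extremalValues_subset ξ η D).antisymm (extremalValues_subset η ξ D)

/-! ### Trial functions -/

theorem mem_extremalValues_of_coeff (ξ : S3) {S : Finset ℕ} (hS : 0 ∉ S) (c : ℕ → ℝ) {D : ℝ}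
    (h1 : 2 * Real.pi ^ 2 * ∑ n ∈ S, eigen n * c n ^ 2 = 1)
    (h2 : 2 * Real.pi ^ 2 * ∑ n ∈ S, eigen n ^ 2 * c n ^ 2 = D) :
    (∑ n ∈ S, c n * (n + 1)) ^ 2 ∈ extremalValues ξ D := by
  refine ⟨_, _, _, isH2_zonal ξ (zonalPoly S c), continuous_zonal _ _, ?_, ?_, ?_, ?_⟩
  · have := integral_mul_zonalPoly (integrable_of_continuous (continuous_zonal ξ (cheb 0))) ξ S c
    rw [Finset.sum_eq_zero fun n hn => by
      have h0 : 0 ≠ n := fun h => hS (h.symm ▸ hn)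
      rw [coef, integral_zonal_cheb_of_ne ξ h0, mul_zero]] at this
    simpa [zonal, cheb_zero] using this
  · rw [integral_norm_tangentGrad_zonal, zonalLaplacian_zonalPoly,
      integral_zonalPoly_mul_zonalPoly, ← mul_neg, ← Finset.sum_neg_distrib, ← h1]
    congr 1
    exact Finset.sum_congr rfl fun n _ => by ring
  · simp only [laplacian_zonal, zonalLaplacian_zonalPoly, sq (zonal _ _ _)]
    rw [integral_zonalPoly_mul_zonalPoly, ← h2]
    congr 1
    exact Finset.sum_congr rfl fun n _ => by ring
  · rw [sq_abs, zonal_zonalPoly]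
    congr 1
    refine Finset.sum_congr rfl fun n _ => ?_
    rw [zonal, real_inner_self_eq_norm_sq, norm_eq_of_mem_sphere]
    simp [cheb_eval_one]

/-- Two modes suffice, of eigenvalues 3 ≤ D and λ_N > D. The squared coefficients A and B solve the
two linear constraints and are nonnegative because D lies between the eigenvalues. -/
theorem nonempty_extremalValues (ξ : S3) {D : ℝ} (hD : 3 ≤ D) : (extremalValues ξ D).Nonempty := by
  obtain ⟨N, hN⟩ := exists_nat_gt D
  have hNr : D < eigen N := by unfold eigen; nlinarith
  have hN1 : (1 : ℕ) ≠ N := by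
    rintro rfl
    norm_num at hN
    linarith
  have e1 : eigen 1 = 3 := by norm_num [eigen]
  have hπ := Real.pi_pos
  set l := eigen N with hl
  set A : ℝ := (l - D) / (3 * (l - 3)) / (2 * Real.pi ^ 2) with hA
  set B : ℝ := (D - 3) / (l * (l - 3)) / (2 * Real.pi ^ 2) with hB
  have hl3 : 0 < l - 3 := by linarith
  have hl0 : 0 < l := by linarith
  have hA0 : 0 ≤ A := by
    have : 0 ≤ l - D := by linarith
    positivity
  have hB0 : 0 ≤ B := by
    have : 0 ≤ D - 3 := by linarith
    positivity
  refine ⟨_, mem_extremalValues_of_coeff ξ (S := {1, N}) ?_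
    (fun n => if n = 1 then Real.sqrt A else Real.sqrt B) ?_ ?_⟩
  · simp only [Finset.mem_insert, Finset.mem_singleton, not_or]
    refine ⟨by norm_num, fun h => ?_⟩
    rw [← h] at hN
    norm_num at hN
    linarith
  all_goals
    rw [Finset.sum_pair hN1]
    simp only [if_true, hN1.symm, if_false, Real.sq_sqrt hA0, Real.sq_sqrt hB0, e1, ← hl]
    rw [hA, hB]
    field_simp
    ring

/-- The trial function is the equality case of Cauchy-Schwarz, with coefficients
k(n+1)/(λ_n(λ_n+s)). The vanishing sum says that its ratio ‖Δu‖²/‖∇u‖² is D, and k normalizes the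
gradient. -/
theorem mem_extremalValues_of_sum_eq_zero (ξ : S3) {S : Finset ℕ} (hS : 0 ∉ S) (hne : S.Nonempty)
    {D s : ℝ} (hD : 0 < D) (hs : 0 ≤ s)
    (h : ∑ n ∈ S, ((n : ℝ) + 1) ^ 2 * (eigen n - D) / (eigen n * (eigen n + s) ^ 2) = 0) :
    (D + s) * ((2 * Real.pi ^ 2)⁻¹ * ∑ n ∈ S, weight s n) ∈ extremalValues ξ D := by
  have hπ := Real.pi_pos
  have hp : ∀ n ∈ S, 0 < eigen n := fun n hn => by
    have := three_le_eigen (n := n) (fun h0 => hS (h0 ▸ hn))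
    linarith
  set Y := ∑ n ∈ S, ((n : ℝ) + 1) ^ 2 / (eigen n * (eigen n + s) ^ 2) with hY
  have hYpos : 0 < Y := Finset.sum_pos (fun n hn => by have := hp n hn; positivity) hne
  -- By this identity the value (k Σ weight)² = (Σ weight)²/(2π²Y) becomes the dual bound restricted
  -- to S.
  have hG : ∑ n ∈ S, weight s n = (D + s) * Y := by
    rw [← sub_eq_zero, hY, Finset.mul_sum, ← Finset.sum_sub_distrib, ← h]
    refine Finset.sum_congr rfl fun n hn => ?_
    have := hp n hn
    unfold weight
    field_simp
    ring
  have hX : 0 < 2 * Real.pi ^ 2 * Y := by positivity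
  set k := (Real.sqrt (2 * Real.pi ^ 2 * Y))⁻¹ with hk
  have hk2 : k ^ 2 = (2 * Real.pi ^ 2 * Y)⁻¹ := by rw [hk, inv_pow, Real.sq_sqrt hX.le]
  have s1 : ∑ n ∈ S, eigen n * (k * (((n : ℝ) + 1) / (eigen n * (eigen n + s)))) ^ 2
      = k ^ 2 * Y := by
    rw [hY, Finset.mul_sum]
    refine Finset.sum_congr rfl fun n hn => ?_
    have := hp n hn
    field_simp
  have s2 : ∑ n ∈ S, eigen n ^ 2 * (k * (((n : ℝ) + 1) / (eigen n * (eigen n + s)))) ^ 2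
      = k ^ 2 * (D * Y) := by
    rw [← sub_eq_zero, hY, Finset.mul_sum, Finset.mul_sum, ← Finset.sum_sub_distrib,
      ← mul_zero (k ^ 2), ← h, Finset.mul_sum]
    refine Finset.sum_congr rfl fun n hn => ?_
    have := hp n hn
    field_simp
  have s3 : ∑ n ∈ S, k * (((n : ℝ) + 1) / (eigen n * (eigen n + s))) * (n + 1)
      = k * ∑ n ∈ S, weight s n := by
    rw [Finset.mul_sum]
    refine Finset.sum_congr rfl fun n hn => ?_
    unfold weight
    ring
  have key := mem_extremalValues_of_coeff ξ hS
    (fun n => k * (((n : ℝ) + 1) / (eigen n * (eigen n + s)))) (D := D) ?_ ?_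
  · rw [s3, mul_pow, hk2, hG] at key
    rw [hG]
    convert key using 1
    field_simp
  · rw [s1, hk2]; field_simp
  · rw [s2, hk2]; field_simp

/-- The function whose zero determines the multiplier of the truncated problem. -/
noncomputable def multiplierSum (D : ℝ) (N : ℕ) (s : ℝ) : ℝ :=
  ∑ n ∈ Finset.Ico 1 N, ((n : ℝ) + 1) ^ 2 * (eigen n - D) / (eigen n * (eigen n + s) ^ 2)

/-! ### Solvability of the multiplier equation -/

theorem eigen_pos_of_mem_Ico {N n : ℕ} (hn : n ∈ Finset.Ico 1 N) : 0 < eigen n := by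
  have := three_le_eigen (n := n) (by simp at hn; omega)
  linarith

theorem sq_le_sum_add_one_sq (N : ℕ) :
    (N : ℝ) ^ 2 ≤ ∑ n ∈ Finset.Ico 1 (N + 1), ((n : ℝ) + 1) ^ 2 := by
  induction N with
  | zero => simp
  | succ N ih =>
    rw [Finset.sum_Ico_succ_top (by omega)]
    push_cast
    have : (0 : ℝ) ≤ N := Nat.cast_nonneg N
    nlinarith

/-- For large s the sum behaves like s⁻² Σ (n+1)²(λ_n-D)/λ_n, which is positive for a long enough
truncation. The point S must not depend on N, so that the multipliers stay bounded as N → ∞. -/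
theorem exists_multiplierSum_pos {D : ℝ} (hD : 3 ≤ D) :
    ∃ S : ℝ, 0 ≤ S ∧ ∃ N₀ : ℕ, ∀ N, N₀ ≤ N → 0 < multiplierSum D N S := by
  -- Since λ_n ≥ 3, each term is at least (n+1)² - 4D/3, and the squares add up to at least M².
  -- Moreover λ_n ≥ D for n ≥ M, so longer truncations only add nonnegative terms.
  obtain ⟨M, hM⟩ := exists_nat_gt (4 * D / 3)
  have hlim : Tendsto (fun s : ℝ => s ^ 2 * multiplierSum D (M + 1) s) atTop
      (nhds (∑ n ∈ Finset.Ico 1 (M + 1), ((n : ℝ) + 1) ^ 2 * (eigen n - D) / eigen n)) := by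
    simp only [multiplierSum, Finset.mul_sum]
    refine tendsto_finsetSum _ fun n hn => ?_
    have hp := eigen_pos_of_mem_Ico hn
    have h1 : Tendsto (fun s : ℝ => 1 - eigen n / (eigen n + s)) atTop (nhds (1 - 0)) :=
      tendsto_const_nhds.sub (tendsto_const_nhds.div_atTop
        (tendsto_atTop_add_const_left _ _ tendsto_id))
    have h2 := (h1.pow 2).mul_const (((n : ℝ) + 1) ^ 2 * (eigen n - D) / eigen n)
    simp only [sub_zero, one_pow, one_mul] at h2
    refine h2.congr' ?_
    filter_upwards [eventually_ge_atTop 0] with s hs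
    have : 0 < eigen n + s := by linarith
    field_simp
    ring
  have hpos : 0 < ∑ n ∈ Finset.Ico 1 (M + 1), ((n : ℝ) + 1) ^ 2 * (eigen n - D) / eigen n := by
    have h1 : ∑ n ∈ Finset.Ico 1 (M + 1), (((n : ℝ) + 1) ^ 2 - 4 * D / 3)
        ≤ ∑ n ∈ Finset.Ico 1 (M + 1), ((n : ℝ) + 1) ^ 2 * (eigen n - D) / eigen n := by
      refine Finset.sum_le_sum fun n hn => ?_
      have hp := eigen_pos_of_mem_Ico hn
      have h3 : 3 ≤ eigen n := three_le_eigen (by simp at hn; omega)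
      have e : ((n : ℝ) + 1) ^ 2 = eigen n + 1 := by unfold eigen; ring
      rw [e, le_div_iff₀ hp]
      nlinarith
    rw [Finset.sum_sub_distrib] at h1
    have h2 := sq_le_sum_add_one_sq M
    simp only [Finset.sum_const, Nat.card_Ico, add_tsub_cancel_right, nsmul_eq_mul] at h1
    nlinarith
  obtain ⟨S, hS, hS0⟩ := ((hlim.eventually (lt_mem_nhds hpos)).and
    (eventually_gt_atTop (0 : ℝ))).exists
  have hS1 : 0 < multiplierSum D (M + 1) S := pos_of_mul_pos_right hS (sq_nonneg S)
  refine ⟨S, hS0.le, M + 1, fun N hN => hS1.trans_le ?_⟩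
  unfold multiplierSum
  refine Finset.sum_le_sum_of_subset_of_nonneg (Finset.Ico_subset_Ico_right hN) fun n hn hn' => ?_
  have hp := eigen_pos_of_mem_Ico hn
  have hMn : M ≤ n := by simp at hn hn'; omega
  have hMn' : (M : ℝ) ≤ n := by exact_mod_cast hMn
  have : D ≤ eigen n := by unfold eigen; nlinarith
  have : 0 ≤ eigen n - D := by linarith
  positivity

/-- At s = 0 the sum is Σ w_n - D Σ w_n/λ_n with w_n = `weight 0 n`; the mode n = 1 alone
contributes 4/27 to the second sum. -/
theorem multiplierSum_zero_neg {D : ℝ} (hD : 27 / 4 * ∑' n, weight 0 n < D) {N : ℕ} (hN : 2 ≤ N) :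
    multiplierSum D N 0 < 0 := by
  have h1 : multiplierSum D N 0
      ≤ ∑ n ∈ Finset.Ico 1 N, weight 0 n - D * ∑ n ∈ Finset.Ico 1 N, weight 0 n / eigen n := by
    unfold multiplierSum
    rw [Finset.mul_sum, ← Finset.sum_sub_distrib]
    refine le_of_eq (Finset.sum_congr rfl fun n hn => ?_)
    have hp := eigen_pos_of_mem_Ico hn
    unfold weight
    field_simp
    ring
  have h2 : weight 0 1 / eigen 1 ≤ ∑ n ∈ Finset.Ico 1 N, weight 0 n / eigen n :=
    Finset.single_le_sum (f := fun n => weight 0 n / eigen n)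
      (fun n _ => div_nonneg (weight_nonneg le_rfl n) (eigen_nonneg n)) (by simp; omega)
  have h3 : weight 0 1 / eigen 1 = 4 / 27 := by norm_num [weight, eigen]
  have h4 := (summable_weight le_rfl).sum_le_tsum (Finset.Ico 1 N) fun n _ => weight_nonneg le_rfl n
  have h5 : 0 ≤ ∑' n, weight 0 n := tsum_nonneg (weight_nonneg le_rfl)
  nlinarith

theorem continuousOn_multiplierSum (D : ℝ) (N : ℕ) (S : ℝ) :
    ContinuousOn (multiplierSum D N) (Set.Icc 0 S) := by
  unfold multiplierSum
  refine continuousOn_finsetSum _ fun n hn => ?_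
  have hp := eigen_pos_of_mem_Ico hn
  refine ContinuousOn.div (by fun_prop) (by fun_prop) fun s hs => ?_
  have : 0 < eigen n + s := by linarith [hs.1]
  positivity

/-- A lower bound for the extremal value. -/
theorem le_of_forall_le_weight_sum {ξ : S3} {D V B : ℝ} (hD : 27 / 4 * ∑' n, weight 0 n < D)
    (hD3 : 3 ≤ D) (hV : V ∈ upperBounds (extremalValues ξ D))
    (hB : ∀ s, 0 ≤ s → B ≤ (D + s) * ((2 * Real.pi ^ 2)⁻¹ * ∑' n, weight s n)) : B ≤ V := by
  obtain ⟨S, hS, N₀, hN₀⟩ := exists_multiplierSum_pos hD3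
  have hπ := Real.pi_pos
  have hlim : Tendsto (fun N : ℕ => B - (D + S) * ((2 * Real.pi ^ 2)⁻¹ * ∑' k, weight 0 (k + N)))
      atTop (nhds (B - (D + S) * ((2 * Real.pi ^ 2)⁻¹ * 0))) :=
    tendsto_const_nhds.sub (((tendsto_sum_nat_add (weight 0)).const_mul _).const_mul _)
  simp only [mul_zero, sub_zero] at hlim
  refine le_of_tendsto hlim ?_
  filter_upwards [eventually_ge_atTop (max N₀ 2)] with N hN
  have hN2 : 2 ≤ N := (le_max_right _ _).trans hN
  -- The multiplier s depends on N but stays in [0, S], so the missing tail (D+s) Σ_{n≥N} is at most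
  -- (D+S) times the tail at s = 0, which tends to 0.
  obtain ⟨s, hs, hs0⟩ := intermediate_value_Icc hS (continuousOn_multiplierSum D N S)
    ⟨(multiplierSum_zero_neg hD hN2).le, (hN₀ N ((le_max_left _ _).trans hN)).le⟩
  have hm := hV (mem_extremalValues_of_sum_eq_zero ξ (S := Finset.Ico 1 N) (by simp)
    ⟨1, by simp; omega⟩ (by linarith) hs.1 hs0)
  have hsplit := (summable_weight hs.1).sum_add_tsum_nat_add N
  have hr : ∑ n ∈ Finset.range N, weight s n = ∑ n ∈ Finset.Ico 1 N, weight s n := by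
    rw [Finset.range_eq_Ico, Finset.sum_eq_sum_Ico_succ_bot (by omega), weight_zero, zero_add]
  have htail : ∑' k, weight s (k + N) ≤ ∑' k, weight 0 (k + N) :=
    ((summable_nat_add_iff N).2 (summable_weight hs.1)).tsum_le_tsum
      (fun k => weight_anti le_rfl hs.1 _) ((summable_nat_add_iff N).2 (summable_weight le_rfl))
  have ht0 : 0 ≤ ∑' k, weight 0 (k + N) := tsum_nonneg fun k => weight_nonneg le_rfl _
  have hBs := hB s hs.1
  rw [← hsplit, hr, mul_add, mul_add] at hBs
  have hmono : (D + s) * ((2 * Real.pi ^ 2)⁻¹ * ∑' k, weight s (k + N))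
      ≤ (D + S) * ((2 * Real.pi ^ 2)⁻¹ * ∑' k, weight 0 (k + N)) := by
    have := hs.2
    have : 0 ≤ D + s := by linarith [hs.1]
    have : 0 ≤ ∑' k, weight s (k + N) := tsum_nonneg fun k => weight_nonneg hs.1 _
    gcongr
  linarith

/-! ### The sum of the weights -/

theorem cot_mul_I (y : ℝ) :
    Complex.cot (y * Complex.I) = -Complex.I * ((Real.cosh y / Real.sinh y : ℝ) : ℂ) := by
  rw [Complex.cot, Complex.cos_mul_I, Complex.sin_mul_I]
  push_cast
  rcases eq_or_ne (Complex.sinh y) 0 with h | h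
  · simp [h]
  · field_simp
    rw [Complex.I_sq]
    ring

/-- This is the partial fraction series of π cot(πx) at x = ia. -/
theorem hasSum_inv_sq_add_sq {a : ℝ} (ha : 0 < a) :
    HasSum (fun n : ℕ => 1 / (((n : ℝ) + 1) ^ 2 + a ^ 2))
      ((Real.pi * (Real.cosh (Real.pi * a) / Real.sinh (Real.pi * a)) - 1 / a) / (2 * a)) := by
  have hsum : Summable (fun n : ℕ => 1 / (((n : ℝ) + 1) ^ 2 + a ^ 2)) := by
    have h1 := (summable_nat_add_iff 1).2 (Real.summable_one_div_nat_pow.2 (by norm_num : 1 < 2))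
    refine Summable.of_nonneg_of_le (fun n => by positivity) (fun n => ?_) h1
    push_cast
    gcongr
    nlinarith
  have hx : ((a : ℂ) * Complex.I) ∈ Complex.integerComplement := by
    rintro ⟨k, hk⟩
    have := congrArg Complex.im hk
    simp at this
    exact ha.ne this
  have key := cot_series_rep' hx
  have e : ∀ n : ℕ, 1 / ((a : ℂ) * Complex.I - (n + 1)) + 1 / ((a : ℂ) * Complex.I + (n + 1))
      = -(2 * a * Complex.I) * ((1 / (((n : ℝ) + 1) ^ 2 + a ^ 2) : ℝ) : ℂ) := fun n => by
    have h1 : (a : ℂ) * Complex.I - (n + 1) ≠ 0 := fun h => by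
      have := congrArg Complex.im h
      simp at this
      exact ha.ne' this
    have h2 : (a : ℂ) * Complex.I + (n + 1) ≠ 0 := fun h => by
      have := congrArg Complex.im h
      simp at this
      exact ha.ne' this
    have h3 : (((n : ℂ) + 1) ^ 2 + a ^ 2) ≠ 0 := by
      have : (((n : ℝ) + 1) ^ 2 + a ^ 2) ≠ 0 := by positivity
      exact_mod_cast this
    push_cast
    field_simp
    linear_combination (2 * (a : ℂ) ^ 3 * Complex.I) * Complex.I_sq
  simp only [e] at key
  rw [tsum_mul_left, ← Complex.ofReal_tsum, ← mul_assoc, ← Complex.ofReal_mul, cot_mul_I] at key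
  have hac : (a : ℂ) ≠ 0 := by exact_mod_cast ha.ne'
  have key2 : ((Real.pi * (Real.cosh (Real.pi * a) / Real.sinh (Real.pi * a)) - 1 / a : ℝ) : ℂ)
      = ((2 * a * ∑' n : ℕ, 1 / (((n : ℝ) + 1) ^ 2 + a ^ 2) : ℝ) : ℂ) := by
    have hI : (1 : ℂ) / (a * Complex.I) = -(Complex.I * (1 / a)) := by
      field_simp
      rw [Complex.I_sq]
      ring
    rw [hI] at key
    generalize Real.cosh (Real.pi * a) / Real.sinh (Real.pi * a) = K at *
    generalize (∑' n : ℕ, 1 / (((n : ℝ) + 1) ^ 2 + a ^ 2)) = T at *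
    push_cast at key ⊢
    refine mul_left_cancel₀ (neg_ne_zero.2 Complex.I_ne_zero) ?_
    linear_combination key
  have key3 := Complex.ofReal_injective key2
  rw [key3, mul_div_cancel_left₀ _ (by positivity)]
  exact hsum.hasSum

theorem sum_inv_eigen (N : ℕ) : ∑ n ∈ Finset.range N, 1 / eigen (n + 1)
    = 3 / 4 - 1 / 2 * (1 / ((N : ℝ) + 1)) - 1 / 2 * (1 / (((N + 1 : ℕ) : ℝ) + 1)) := by
  induction N with
  | zero => norm_num
  | succ N ih =>
    rw [Finset.sum_range_succ, ih]
    unfold eigen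
    push_cast
    field_simp
    ring

theorem hasSum_inv_eigen : HasSum (fun n : ℕ => 1 / eigen (n + 1)) (3 / 4) := by
  rw [hasSum_iff_tendsto_nat_of_nonneg fun n => div_nonneg zero_le_one (eigen_nonneg (n + 1))]
  simp only [sum_inv_eigen]
  have h : Tendsto (fun N : ℕ => 1 / ((N : ℝ) + 1)) atTop (nhds 0) :=
    tendsto_one_div_add_atTop_nhds_zero_nat
  have h' : Tendsto (fun N : ℕ => 1 / (((N + 1 : ℕ) : ℝ) + 1)) atTop (nhds 0) :=
    h.comp (tendsto_add_atTop_nat 1)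
  have := ((h.const_mul (1 / 2)).const_sub (3 / 4)).sub (h'.const_mul (1 / 2))
  rwa [mul_zero, sub_zero, sub_zero] at this

theorem tsum_weight {s a : ℝ} (ha : 0 < a) (hs : s = a ^ 2 + 1) :
    s * ∑' n, weight s n
      = Real.pi * a / 2 * (Real.cosh (Real.pi * a) / Real.sinh (Real.pi * a)) - 3 / 4 + 1 / s := by
  have hs0 : 0 < s := by rw [hs]; positivity
  have h1 := (hasSum_nat_add_iff' 1).2 (hasSum_inv_sq_add_sq ha)
  have h2 := hasSum_inv_eigen.add (h1.mul_left (a ^ 2))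
  have h3 := (hasSum_nat_add_iff' 1).2 ((summable_weight hs0.le).hasSum.mul_left s)
  -- Partial fractions: s(λ+1)/(λ(λ+s)) = 1/λ + a²/(λ+s), where λ_n + s = (n+1)² + a². The sum
  -- starts at n = 1, so the first term 1/(1+a²) of the cotangent series is removed.
  have h4 := h3.unique (h2.congr_fun fun n => by
    have hp : 0 < eigen (n + 1) := by
      have := three_le_eigen (n := n + 1) (by omega)
      linarith
    have e1 : (((n + 1 : ℕ) : ℝ) + 1) ^ 2 = eigen (n + 1) + 1 := by unfold eigen; ring
    rw [weight, e1, hs]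
    field_simp
    ring)
  simp only [Finset.sum_range_one, weight_zero, mul_zero, sub_zero] at h4
  rw [h4, hs]
  field_simp
  push_cast
  ring

theorem one_le_coth {y : ℝ} (hy : 0 < y) : 1 ≤ Real.cosh y / Real.sinh y := by
  rw [one_le_div (Real.sinh_pos_iff.2 hy)]
  exact (Real.sinh_lt_cosh y).le

/-- The excess of coth over 1 is 2/(exp(2y) - 1), and exp(2y) - 1 ≥ 4y³/3. Cubic decay is enough to
make the error in `tsum_weight` of order 1/s. -/
theorem coth_le {y : ℝ} (hy : 0 < y) : Real.cosh y / Real.sinh y ≤ 1 + 3 / (2 * y ^ 3) := by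
  have hsh := Real.sinh_pos_iff.2 hy
  have h1 := Real.sum_le_exp_of_nonneg (x := 2 * y) (by positivity) 4
  simp [Finset.sum_range_succ, Nat.factorial] at h1
  have h2 : Real.cosh y = Real.sinh y + Real.exp (-y) := by
    rw [Real.cosh_eq, Real.sinh_eq]; ring
  have h3 : Real.exp (-y) * (2 * y ^ 3) ≤ 3 * Real.sinh y := by
    have e : Real.exp (2 * y) * Real.exp (-y) = Real.exp y := by rw [← Real.exp_add]; ring_nf
    have h4 := Real.exp_pos (-y)
    rw [Real.sinh_eq]
    have h5 : 4 / 3 * y ^ 3 ≤ Real.exp (2 * y) - 1 := by nlinarith [sq_nonneg y]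
    nlinarith [mul_le_mul_of_nonneg_right h5 h4.le]
  have h6 := (div_le_div_iff₀ hsh (by positivity : 0 < 2 * y ^ 3)).2 h3
  rw [h2, add_div, div_self hsh.ne']
  linarith

theorem le_tsum_weight {s a : ℝ} (ha : 0 < a) (hs : s = a ^ 2 + 1) :
    Real.pi * a / 2 - 3 / 4 ≤ s * ∑' n, weight s n := by
  have hπ := Real.pi_pos
  have hs0 : 0 < s := by rw [hs]; positivity
  have h1 := one_le_coth (y := Real.pi * a) (by positivity)
  rw [tsum_weight ha hs]
  have h2 : Real.pi * a / 2 * 1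
      ≤ Real.pi * a / 2 * (Real.cosh (Real.pi * a) / Real.sinh (Real.pi * a)) := by gcongr
  have h3 : 0 < 1 / s := by positivity
  linarith

theorem tsum_weight_le {s a : ℝ} (ha : 1 ≤ a) (hs : s = a ^ 2 + 1) :
    s * ∑' n, weight s n ≤ Real.pi * a / 2 - 3 / 4 + 2 / s := by
  have hπ := Real.pi_gt_three
  have hπ0 := Real.pi_pos
  have hs0 : 0 < s := by rw [hs]; positivity
  have ha0 : 0 < a := by linarith
  have h1 := coth_le (y := Real.pi * a) (by positivity)
  rw [tsum_weight ha0 hs]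
  have h2 : Real.pi * a / 2 * (Real.cosh (Real.pi * a) / Real.sinh (Real.pi * a))
      ≤ Real.pi * a / 2 * (1 + 3 / (2 * (Real.pi * a) ^ 3)) := by gcongr
  have h3 : Real.pi * a / 2 * (1 + 3 / (2 * (Real.pi * a) ^ 3))
      = Real.pi * a / 2 + 3 / (4 * Real.pi ^ 2 * a ^ 2) := by field_simp; ring
  have h4 : 3 / (4 * Real.pi ^ 2 * a ^ 2) ≤ 1 / s := by
    rw [div_le_div_iff₀ (by positivity) hs0, hs]
    nlinarith [mul_le_mul hπ.le hπ.le (by norm_num) hπ0.le, mul_pos ha0 ha0]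
  have h5 : 2 / s = 1 / s + 1 / s := by ring
  linarith

/-! ### Asymptotics -/

/-- The asymptotic expansion of `2π² 𝕍(D)`, where `q = √D`. -/
noncomputable def expansion (q : ℝ) : ℝ :=
  Real.pi * q - 3 / 2 - (9 + 4 * Real.pi ^ 2) / (8 * Real.pi * q)

theorem exists_le_expansion {q : ℝ} (hq : 4 ≤ q) :
    ∃ s, 0 ≤ s ∧ (q ^ 2 + s) * ∑' n, weight s n ≤ expansion q + 40 / q ^ 2 := by
  have hπ := Real.pi_gt_three
  have hπ0 := Real.pi_pos
  have hq0 : 0 < q := by linarith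
  -- This z minimizes (πq/2)z² - (3/2)z, the part of the objective near y = 1 that decides the q⁻¹
  -- term.
  set z : ℝ := 3 / (2 * Real.pi * q) with hz
  have hz0 : 0 < z := by positivity
  have hz1 : z ≤ 1 := by rw [hz, div_le_one (by positivity)]; nlinarith
  set y : ℝ := 1 + z with hy
  have hy1 : 1 ≤ y := by linarith
  have hy2 : y ≤ 2 := by linarith
  have hy0 : 0 < y := by linarith
  set s : ℝ := (q / y) ^ 2 with hs
  have hp : 2 ≤ q / y := by rw [le_div_iff₀ hy0]; linarith
  have hs2 : 4 ≤ s := by rw [hs]; nlinarith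
  set a : ℝ := Real.sqrt (s - 1) with ha
  have ha2 : s = a ^ 2 + 1 := by rw [ha, Real.sq_sqrt (by linarith)]; ring
  have ha1 : 1 ≤ a := by rw [ha]; exact Real.one_le_sqrt.2 (by linarith)
  refine ⟨s, by linarith, ?_⟩
  have hau : a ≤ q / y - y / (2 * q) := by
    have h1 : y / (2 * q) = 1 / (2 * (q / y)) := by field_simp
    rw [ha, h1]
    have h2 : 1 / (2 * (q / y)) ≤ 1 / (2 * 2) := by gcongr
    refine Real.sqrt_le_iff.2 ⟨by linarith, ?_⟩
    have h3 : (q / y) * (1 / (2 * (q / y))) = 1 / 2 := by field_simp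
    rw [hs]
    nlinarith [sq_nonneg (1 / (2 * (q / y)))]
  have hG := tsum_weight_le ha1 ha2
  have hsq : q ^ 2 + s = (1 + y ^ 2) * s := by rw [hs]; field_simp; ring
  have h2s : 2 / s = 2 * y ^ 2 / q ^ 2 := by rw [hs]; field_simp
  rw [hsq, mul_assoc]
  have hstep : (1 + y ^ 2) * (s * ∑' n, weight s n)
      ≤ (1 + y ^ 2) * (Real.pi * (q / y - y / (2 * q)) / 2 - 3 / 4 + 2 * y ^ 2 / q ^ 2) := by
    gcongr
    rw [← h2s]
    refine hG.trans ?_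
    gcongr
  refine hstep.trans ?_
  have e : (1 + y ^ 2) * (Real.pi * (q / y - y / (2 * q)) / 2 - 3 / 4 + 2 * y ^ 2 / q ^ 2)
      = Real.pi * q + (Real.pi * q / 2) * z ^ 2 / y - 3 / 2 - 3 / 2 * z - 3 / 4 * z ^ 2
        - Real.pi / (4 * q) * (y * (1 + y ^ 2)) + (1 + y ^ 2) * (2 * y ^ 2) / q ^ 2 := by
    have hzy : z = y - 1 := by linarith
    rw [hzy]
    field_simp
    ring
  have b1 : (Real.pi * q / 2) * z ^ 2 / y ≤ 9 / (8 * Real.pi * q) := by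
    have : (Real.pi * q / 2) * z ^ 2 = 9 / (8 * Real.pi * q) := by rw [hz]; field_simp; ring
    rw [this]
    exact div_le_self (by positivity) hy1
  have b2 : 3 / 2 * z = 18 / (8 * Real.pi * q) := by rw [hz]; field_simp; ring
  have b3 : Real.pi / (4 * q) * 2 ≤ Real.pi / (4 * q) * (y * (1 + y ^ 2)) := by
    gcongr
    nlinarith
  have b4 : (1 + y ^ 2) * (2 * y ^ 2) / q ^ 2 ≤ 40 / q ^ 2 := by
    gcongr
    calc (1 + y ^ 2) * (2 * y ^ 2) ≤ (1 + 2 ^ 2) * (2 * 2 ^ 2) := by gcongr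
      _ = 40 := by norm_num
  have b5 : expansion q = Real.pi * q - 3 / 2 - 9 / (8 * Real.pi * q) - Real.pi / (4 * q) * 2 := by
    unfold expansion
    field_simp
    ring
  have b6 : 18 / (8 * Real.pi * q) = 9 / (8 * Real.pi * q) + 9 / (8 * Real.pi * q) := by ring
  rw [e, b5]
  nlinarith [sq_nonneg z]

/-- The square is completed around the approximate minimizer y = 1 + 3/(2πq). Apart from this
square, the remainders are of order (y-1)², (y-1)/q and q⁻³ for bounded y bounded away from 0. -/
theorem expansion_identity {q y : ℝ} (hq : 0 < q) (hy : 0 < y) :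
    (1 + y ^ 2) * (Real.pi * (q / y - y / (2 * q) - y ^ 3 / (2 * q ^ 3)) / 2 - 3 / 4)
      = expansion q + (Real.pi * q / 2 * (y - 1 - 3 / (2 * Real.pi) / q) ^ 2) / y
        - 3 / 2 * (y - 1) ^ 2 / y + 9 / (8 * Real.pi) * ((y - 1) / q) / y
        - 3 / 4 * (y - 1) ^ 2 - Real.pi / 4 * (4 + 3 * (y - 1) + (y - 1) ^ 2) * ((y - 1) / q)
        - (1 + y ^ 2) * Real.pi * y ^ 3 / 4 / q ^ 3 := by
  have hπ := Real.pi_pos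
  unfold expansion
  field_simp
  ring

set_option maxHeartbeats 1000000 in
theorem expansion_le_aux {q z : ℝ} (hq : 200 ≤ q) (hz1 : -(3 / 4) ≤ z) (hz2 : z ≤ 3) :
    expansion q - 2000 / q ^ 2 ≤ (1 + (1 + z) ^ 2) * (Real.pi * (q / (1 + z)
      - (1 + z) / (2 * q) - (1 + z) ^ 3 / (2 * q ^ 3)) / 2 - 3 / 4) := by
  have hπ := Real.pi_gt_three
  have hπ4 := Real.pi_lt_four
  have hπ0 := Real.pi_pos
  have hq0 : 0 < q := by linarith
  set y : ℝ := 1 + z with hy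
  have hy0 : 1 / 4 ≤ y := by linarith
  have hy4 : y ≤ 4 := by linarith
  have hypos : 0 < y := by linarith
  set c : ℝ := 3 / (2 * Real.pi) with hc
  have hc0 : 0 < c := by positivity
  have hc1 : c ≤ 1 / 2 := by rw [hc, div_le_div_iff₀ (by positivity) (by norm_num)]; linarith
  set w : ℝ := z - c / q with hw
  have e : (1 + y ^ 2) * (Real.pi * (q / y - y / (2 * q) - y ^ 3 / (2 * q ^ 3)) / 2 - 3 / 4)
      = expansion q + (Real.pi * q / 2 * w ^ 2) / y - 3 / 2 * z ^ 2 / y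
        + 9 / (8 * Real.pi) * (z / q) / y
        - 3 / 4 * z ^ 2 - Real.pi / 4 * (4 + 3 * z + z ^ 2) * (z / q)
        - (1 + y ^ 2) * Real.pi * y ^ 3 / 4 / q ^ 3 := by
    have hzy : z = y - 1 := by rw [hy]; ring
    rw [hw, hc, hzy]
    exact expansion_identity hq0 hypos
  rw [e]
  have hinv : 1 / y ≤ 4 := by rw [div_le_iff₀ hypos]; linarith
  have hinv4 : 1 / 4 ≤ 1 / y := by gcongr
  have hinv0 : 0 < 1 / y := by positivity
  have b1 : q / 3 * w ^ 2 ≤ (Real.pi * q / 2 * w ^ 2) / y := by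
    have h1 : q / 3 * w ^ 2 ≤ (Real.pi * q / 2 * w ^ 2) * (1 / 4) := by
      have : 0 ≤ q * w ^ 2 := by positivity
      nlinarith
    calc _ ≤ _ := h1
      _ ≤ (Real.pi * q / 2 * w ^ 2) * (1 / y) := by gcongr
      _ = _ := by ring
  have b2 : 3 / 2 * z ^ 2 / y ≤ 6 * z ^ 2 := by
    rw [show 3 / 2 * z ^ 2 / y = 3 / 2 * z ^ 2 * (1 / y) by ring]
    nlinarith [sq_nonneg z]
  set t : ℝ := |z| / q with ht
  have ht0 : 0 ≤ t := by positivity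
  have hzq : |z / q| = t := by rw [abs_div, abs_of_pos hq0]
  have b3 : -(2 * t) ≤ 9 / (8 * Real.pi) * (z / q) / y := by
    have h1 : |9 / (8 * Real.pi) * (z / q) / y| ≤ 2 * t := by
      rw [abs_div, abs_mul, hzq, abs_of_pos hypos, abs_of_pos (by positivity : 0 < 9 / (8 * Real.pi)),
        div_eq_mul_one_div]
      have h2 : 9 / (8 * Real.pi) ≤ 1 / 2 := by
        rw [div_le_div_iff₀ (by positivity) (by norm_num)]; linarith
      calc _ ≤ 1 / 2 * t * 4 := by gcongr
        _ = _ := by ring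
    exact (abs_le.1 h1).1
  have b4 : Real.pi / 4 * (4 + 3 * z + z ^ 2) * (z / q) ≤ 22 * t := by
    have h0 : 0 ≤ 4 + 3 * z + z ^ 2 := by nlinarith
    have h1 : 4 + 3 * z + z ^ 2 ≤ 22 := by nlinarith
    calc _ ≤ Real.pi / 4 * (4 + 3 * z + z ^ 2) * t := by
          gcongr
          rw [← hzq]; exact le_abs_self _
      _ ≤ 4 / 4 * 22 * t := by gcongr
      _ = _ := by ring
  have b5 : (1 + y ^ 2) * Real.pi * y ^ 3 / 4 / q ^ 3 ≤ 1100 / q ^ 3 := by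
    gcongr
    have : (1 + y ^ 2) * Real.pi * y ^ 3 ≤ (1 + 4 ^ 2) * 4 * 4 ^ 3 := by gcongr
    linarith
  have b6 : 1100 / q ^ 3 ≤ 1100 / q ^ 2 := by
    gcongr <;> linarith
  have b7 : 2 * t ≤ z ^ 2 + 1 / q ^ 2 := by
    have h1 : 0 ≤ (|z| - 1 / q) ^ 2 := sq_nonneg _
    have h2 : (|z| - 1 / q) ^ 2 = z ^ 2 - 2 * t + 1 / q ^ 2 := by
      rw [ht, sub_sq, sq_abs]
      field_simp
    linarith
  have b8 : z ^ 2 ≤ 2 * w ^ 2 + 1 / q ^ 2 := by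
    have h1 : z ^ 2 = 2 * w ^ 2 + 2 * (c / q) ^ 2 - (w - c / q) ^ 2 := by rw [hw]; ring
    have h2 : (c / q) ^ 2 ≤ 1 / 2 * (1 / q ^ 2) := by
      rw [div_pow, div_eq_mul_one_div]
      gcongr
      nlinarith
    have h3 := sq_nonneg (w - c / q)
    linarith
  -- The remainders total at most 18.75 z² plus a multiple of q⁻², hence 37.5 w² plus such a
  -- multiple; q ≥ 200 lets the completed square absorb the former.
  have b9 : 66 * w ^ 2 ≤ q / 3 * w ^ 2 :=
    mul_le_mul_of_nonneg_right (by linarith) (sq_nonneg w)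
  have h2000 : 2000 / q ^ 2 = 2000 * (1 / q ^ 2) := by ring
  have h1100 : 1100 / q ^ 2 = 1100 * (1 / q ^ 2) := by ring
  have : 0 ≤ 1 / q ^ 2 := by positivity
  rw [h1100] at b6
  rw [h2000]
  linarith

theorem sub_le_sqrt {p : ℝ} (hp : 1 ≤ p) :
    p - 1 / (2 * p) - 1 / (2 * p ^ 3) ≤ Real.sqrt (p ^ 2 - 1) := by
  refine Real.le_sqrt_of_sq_le ?_
  have hp0 : 0 < p := by linarith
  set r : ℝ := 1 / p with hr
  have hr1 : r ≤ 1 := by rw [hr, div_le_one hp0]; exact hp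
  have hr0 : 0 < r := by positivity
  have hpr : p * r = 1 := by rw [hr]; field_simp
  have e1 : 1 / (2 * p) = r / 2 := by rw [hr]; field_simp
  have e2 : 1 / (2 * p ^ 3) = r ^ 3 / 2 := by rw [hr]; field_simp
  rw [e1, e2]
  have e3 : (p - r / 2 - r ^ 3 / 2) ^ 2
      = p ^ 2 - p * r - (p * r) * r ^ 2 + r ^ 2 / 4 + r ^ 4 / 2 + r ^ 6 / 4 := by ring
  rw [e3, hpr]
  have h2 : r ^ 2 ≤ 1 := by nlinarith
  have h4 : r ^ 4 ≤ r ^ 2 := pow_le_pow_of_le_one hr0.le hr1 (by norm_num)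
  have h6 : r ^ 6 ≤ r ^ 2 := pow_le_pow_of_le_one hr0.le hr1 (by norm_num)
  linarith

theorem expansion_le {q s : ℝ} (hq : 200 ≤ q) (hs : 0 ≤ s) :
    expansion q - 2000 / q ^ 2 ≤ (q ^ 2 + s) * ∑' n, weight s n := by
  have hπ := Real.pi_gt_three
  have hπ0 := Real.pi_pos
  have hq0 : 0 < q := by linarith
  have hX : expansion q - 2000 / q ^ 2 ≤ Real.pi * q := by
    unfold expansion
    have : 0 ≤ (9 + 4 * Real.pi ^ 2) / (8 * Real.pi * q) := by positivity
    have : 0 ≤ 2000 / q ^ 2 := by positivity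
    linarith
  have hG0 : ∀ t, 0 ≤ t → 0 ≤ ∑' n, weight t n := fun t ht => tsum_nonneg (weight_nonneg ht)
  have hlow : ∀ t b, 0 < b → b ^ 2 + 1 ≤ t → Real.pi * b / 2 - 3 / 4 ≤ t * ∑' n, weight t n :=
    fun t b hb hbt => by
      have h1 : t = Real.sqrt (t - 1) ^ 2 + 1 := by rw [Real.sq_sqrt (by nlinarith)]; ring
      have h2 : b ≤ Real.sqrt (t - 1) := Real.le_sqrt_of_sq_le (by linarith)
      refine le_trans ?_ (le_tsum_weight (hb.trans_le h2) h1)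
      gcongr
  -- Far from s = q² the crude bound πq ≥ `expansion q` is enough. For small s, monotonicity of G
  -- gives q²G(s) ≥ 16(πq/10 - 3/4); for s > 16q², sG(s) ≥ 3πq/2 - 3/4. Between them y = q/√s lies
  -- in [1/4, 4].
  rcases le_or_gt s (q ^ 2 / 16) with h | h
  · have hanti : ∑' n, weight (q ^ 2 / 16) n ≤ ∑' n, weight s n :=
      (summable_weight (by positivity)).tsum_le_tsum (fun n => weight_anti hs h n)
        (summable_weight hs)
    have h1 := hlow (q ^ 2 / 16) (q / 5) (by positivity) (by nlinarith)
    have h2 : q ^ 2 * ∑' n, weight (q ^ 2 / 16) n ≤ (q ^ 2 + s) * ∑' n, weight s n := by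
      have := hG0 (q ^ 2 / 16) (by positivity)
      gcongr
      linarith
    nlinarith
  rcases le_or_gt (16 * q ^ 2) s with h' | h'
  · have h1 := hlow s (3 * q) (by positivity) (by nlinarith)
    have h2 := hG0 s hs
    have h3 : 0 ≤ q ^ 2 * ∑' n, weight s n := by positivity
    nlinarith
  · set p : ℝ := Real.sqrt s with hp
    have hp2 : p ^ 2 = s := Real.sq_sqrt hs
    have hpq : q / 4 ≤ p := Real.le_sqrt_of_sq_le (by nlinarith)
    have hpq' : p ≤ 4 * q := Real.sqrt_le_iff.2 ⟨by positivity, by nlinarith⟩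
    have hp0 : 0 < p := by linarith
    have hy : 1 + (q / p - 1) = q / p := by ring
    have hmain := expansion_le_aux (q := q) (z := q / p - 1) hq
      (by
        have : 1 / 4 ≤ q / p := by rw [le_div_iff₀ hp0]; linarith
        linarith)
      (by
        have : q / p ≤ 4 := by rw [div_le_iff₀ hp0]; linarith
        linarith)
    rw [hy] at hmain
    refine hmain.trans ?_
    have ha := sub_le_sqrt (p := p) (by linarith)
    have ha0 : 0 < Real.sqrt (p ^ 2 - 1) := Real.sqrt_pos.2 (by nlinarith)
    have hG := le_tsum_weight (s := s) ha0 (by rw [Real.sq_sqrt (by nlinarith), hp2]; ring)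
    have e1 : q / (q / p) - q / p / (2 * q) - (q / p) ^ 3 / (2 * q ^ 3)
        = p - 1 / (2 * p) - 1 / (2 * p ^ 3) := by field_simp
    have e2 : (q ^ 2 + s) * ∑' n, weight s n = (1 + (q / p) ^ 2) * (s * ∑' n, weight s n) := by
      rw [← hp2]; field_simp; ring
    rw [e1, e2]
    gcongr
    refine le_trans ?_ hG
    gcongr

/-- The point `(1, 0, 0, 0)` of the sphere. -/
noncomputable def basePoint : S3 := ⟨EuclideanSpace.single 0 1, by simp⟩

/-! ### The supremum and its expansion -/

theorem isLUB_extremalValues (ξ : S3) {D : ℝ} (hD : 3 ≤ D) :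
    IsLUB (extremalValues ξ D) (sSup (extremalValues basePoint D)) := by
  rw [extremalValues_eq ξ basePoint]
  exact isLUB_csSup (nonempty_extremalValues _ hD)
    -- The dual bound at s = 0 already gives finiteness.
    ⟨_, fun _ hv => le_of_mem_extremalValues hv le_rfl⟩

theorem abs_extremalValue_sub_expansion_le {q V : ℝ} {ξ : S3} (hq : 200 ≤ q)
    (hq' : 27 / 4 * ∑' n, weight 0 n < q) (hV : IsLUB (extremalValues ξ (q ^ 2)) V) :
    |2 * Real.pi ^ 2 * V - expansion q| ≤ 2000 / q ^ 2 := by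
  have hπ := Real.pi_pos
  rw [abs_le]
  constructor
  · have key := le_of_forall_le_weight_sum
      (B := (2 * Real.pi ^ 2)⁻¹ * (expansion q - 2000 / q ^ 2)) (by nlinarith) (by nlinarith) hV.1
      (fun s hs => by
        rw [mul_left_comm (q ^ 2 + s)]
        gcongr
        exact expansion_le hq hs)
    rw [inv_mul_le_iff₀ (by positivity)] at key
    linarith
  · obtain ⟨s, hs, h⟩ := exists_le_expansion (q := q) (by linarith)
    have key : V ≤ (2 * Real.pi ^ 2)⁻¹ * (expansion q + 40 / q ^ 2) :=
      hV.2 fun v hv => (le_of_mem_extremalValues hv hs).trans (by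
        rw [mul_left_comm (q ^ 2 + s)]
        gcongr)
    rw [← div_eq_inv_mul, le_div_iff₀ (by positivity)] at key
    have : 40 / q ^ 2 ≤ 2000 / q ^ 2 := by gcongr; norm_num
    linarith

theorem isBigO_extremalValue {V : ℝ → ℝ} {ξ : S3}
    (hV : ∀ D, 3 ≤ D → IsLUB (extremalValues ξ D) (V D)) :
    (fun D : ℝ => V D -
          (1 / (2 * Real.pi) * D ^ (1 / 2 : ℝ) - 3 / (4 * Real.pi ^ 2)
            - (9 + 4 * Real.pi ^ 2) / (16 * Real.pi ^ 3) * D ^ (-(1 / 2) : ℝ)))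
        =O[atTop] (fun D : ℝ => D⁻¹) := by
  have hπ := Real.pi_pos
  refine IsBigO.of_bound ((2 * Real.pi ^ 2)⁻¹ * 2000) ?_
  filter_upwards [eventually_ge_atTop (200 ^ 2 : ℝ),
    eventually_gt_atTop ((27 / 4 * ∑' n, weight 0 n) ^ 2)] with D h1 h2
  have hD0 : 0 < D := by linarith
  set q := Real.sqrt D with hq
  have hq2 : q ^ 2 = D := Real.sq_sqrt hD0.le
  have hq200 : 200 ≤ q := Real.le_sqrt_of_sq_le h1
  have hqw : 27 / 4 * ∑' n, weight 0 n < q := Real.lt_sqrt_of_sq_lt h2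
  have hq0 : 0 < q := by linarith
  have key := abs_extremalValue_sub_expansion_le (V := V D) (ξ := ξ) hq200 hqw
    (hq2 ▸ hV D (by linarith))
  rw [Real.rpow_neg hD0.le, ← Real.sqrt_eq_rpow, ← hq]
  have e : V D - (1 / (2 * Real.pi) * q - 3 / (4 * Real.pi ^ 2)
      - (9 + 4 * Real.pi ^ 2) / (16 * Real.pi ^ 3) * q⁻¹)
      = (2 * Real.pi ^ 2)⁻¹ * (2 * Real.pi ^ 2 * V D - expansion q) := by
    unfold expansion
    field_simp
    ring
  rw [e, norm_mul, norm_inv, Real.norm_of_nonneg (by positivity : 0 ≤ 2 * Real.pi ^ 2),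
    Real.norm_of_nonneg (by positivity : 0 ≤ D⁻¹), Real.norm_eq_abs,
    mul_assoc (2 * Real.pi ^ 2)⁻¹ 2000 D⁻¹, ← div_eq_mul_inv 2000]
  rw [hq2] at key
  exact mul_le_mul_of_nonneg_left key (by positivity)

end ThreeSphere

theorem theorem3p6 :
    -- every element of `H²(𝕊³)` has a unique continuous representative
    (∀ u : ThreeSphere.S3 → ℝ, ThreeSphere.MemH2 u →
      ∃! w : ThreeSphere.S3 → ℝ, Continuous w ∧ w =ᵐ[ThreeSphere.surf] u) ∧
    -- the extremal value is finite and independent of the point, and has the asymptotics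
    ∃ V : ℝ → ℝ,
      (∀ (ξ : ThreeSphere.S3) (D : ℝ), 3 ≤ D →
        IsLUB (ThreeSphere.extremalValues ξ D) (V D)) ∧
      (fun D : ℝ => V D -
          (1 / (2 * Real.pi) * D ^ (1 / 2 : ℝ) - 3 / (4 * Real.pi ^ 2)
            - (9 + 4 * Real.pi ^ 2) / (16 * Real.pi ^ 3) * D ^ (-(1 / 2) : ℝ)))
        =O[atTop] (fun D : ℝ => D⁻¹) :=
  ⟨fun _ hu => ThreeSphere.existsUnique_continuous_representative hu,
    fun D => sSup (ThreeSphere.extremalValues ThreeSphere.basePoint D),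
    fun ξ _ hD => ThreeSphere.isLUB_extremalValues ξ hD,
    ThreeSphere.isBigO_extremalValue fun _ hD =>
      ThreeSphere.isLUB_extremalValues ThreeSphere.basePoint hD⟩
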